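/- Let $P$ be a simple polygon in the Euclidean plane, with boundary $\partial P$ (a simple closed polygonal chain) and interior $\mathrm{int}(P)$ (the set enclosed by $\partial P$); as a closed region, $P=\mathrm{int}(P)\cup\partial P$. Points $p,q$ are visible to each other if $pq\setminus\{p,q\}\subseteq \mathrm{int}(P)$. A diagonal is a segment joining two non-consecutive vertices that are visible to each other. An open mobile guard is an edge or a diagonal of $P$ without its endpoints. A set $G$ of open mobile guards is a hidden open mobile guard set of $P$ if every point of $\mathrm{int}(P)$ is visible to some point of some guard in $G$, and for any two distinct guards $g_1,g_2\in G$ no point of $g_1$ and point of $g_2$ are visible to each other. $P$ is monotone if it can be rotated so that every vertical line meets the closed region $P$ in a connected (possibly empty) set. A geodesic path between two vertices of $P$ is a shortest path between them among all continuous paths in the closed region $P$; its open edges are the connected components of the path (as a point set) minus the vertices of $P$. Then every monotone polygon $P$ admits a hidden open mobile guard set. More precisely, suppose $P$ is rotated so that every vertical line meets it in a connected set, and let $u$ be a leftmost and $v$ a rightmost vertex of $P$. Then there is a geodesic path in $P$ from $u$ to $v$, and for every such geodesic path $\gamma$: the open edges of $\gamma$ are edges or diagonals of $P$ without their endpoints,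 and they form a hidden open mobile guard set of $P$; moreover, every vertical line that meets $P$ meets $\gamma$. -/

import Mathlib

namespace HiddenGuards

/-- The Euclidean plane. -/
abbrev Plane : Type := EuclideanSpace ℝ (Fin 2)

/-- The boundary of `P` (the union of its edges) is a simple closed polygonal chain: there are at
least three edges, no edge is degenerate, two consecutive edges meet only in their common vertex,
and any two other edges are disjoint. A vertex may have interior angle `π`. -/
structure IsSimple {n : ℕ} (P : Polygon Plane n) : Prop where
  three_le : 3 ≤ n
  nondegenerate : P.HasNondegenerateEdges
  consecutive : ∀ i : Fin n,
    P.edgeSet ℝ i ∩ P.edgeSet ℝ (finRotate n i) = {P (finRotate n i)}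
  disjoint : ∀ i j : Fin n, i ≠ j → j ≠ finRotate n i → i ≠ finRotate n j →
    Disjoint (P.edgeSet ℝ i) (P.edgeSet ℝ j)

/-- The set enclosed by the boundary of `P`: the union of the bounded connected components of the
complement of the boundary. -/
def polyInterior {n : ℕ} (P : Polygon Plane n) : Set Plane :=
  {x | x ∉ P.boundary ℝ ∧ Bornology.IsBounded (connectedComponentIn (P.boundary ℝ)ᶜ x)}

/-- The polygon as a closed region: its interior together with its boundary. -/
def region {n : ℕ} (P : Polygon Plane n) : Set Plane :=
  polyInterior P ∪ P.boundary ℝ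

/-- The line perpendicular to the direction `e` at height `c`. If the plane is rotated such that
the unit vector `e` points along the positive `x`-axis, these are the vertical lines. -/
def crossLine (e : Plane) (c : ℝ) : Set Plane :=
  {x | inner ℝ e x = c}

/-- `P` is monotone in direction `e`: every line perpendicular to `e` meets the closed region of
`P` in a connected (possibly empty) set. -/
def IsMonotoneIn {n : ℕ} (P : Polygon Plane n) (e : Plane) : Prop :=
  ∀ c : ℝ, IsPreconnected (region P ∩ crossLine e c)

/-- `P` is monotone: it can be rotated such that it meets every vertical line in a connected
set. -/
def IsMonotone {n : ℕ} (P : Polygon Plane n) : Prop :=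
  ∃ e : Plane, ‖e‖ = 1 ∧ IsMonotoneIn P e

/-- Vertex `i` is a leftmost vertex of `P`, with `e` as the direction pointing to the right. -/
def IsLeftmost {n : ℕ} (P : Polygon Plane n) (e : Plane) (i : Fin n) : Prop :=
  ∀ j : Fin n, inner ℝ e (P i) ≤ inner ℝ e (P j)

/-- Vertex `i` is a rightmost vertex of `P`, with `e` as the direction pointing to the right. -/
def IsRightmost {n : ℕ} (P : Polygon Plane n) (e : Plane) (i : Fin n) : Prop :=
  ∀ j : Fin n, inner ℝ e (P j) ≤ inner ℝ e (P i)

/-- The points `p` and `q` are visible to each other in `P`: the segment `pq` without its two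
endpoints lies in the interior of `P`. -/
def Visible {n : ℕ} (P : Polygon Plane n) (p q : Plane) : Prop :=
  segment ℝ p q \ {p, q} ⊆ polyInterior P

/-- The vertices `i` and `j` are the endpoints of a diagonal of `P`. -/
def IsDiagonal {n : ℕ} (P : Polygon Plane n) (i j : Fin n) : Prop :=
  i ≠ j ∧ j ≠ finRotate n i ∧ i ≠ finRotate n j ∧ Visible P (P i) (P j)

/-- `g` is an open mobile guard of `P`: an edge or a diagonal of `P` without its endpoints. -/
def IsOpenMobileGuard {n : ℕ} (P : Polygon Plane n) (g : Set Plane) : Prop :=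
  (∃ i : Fin n, g = openSegment ℝ (P i) (P (finRotate n i))) ∨
    ∃ i j : Fin n, IsDiagonal P i j ∧ g = openSegment ℝ (P i) (P j)

/-- The guard `g` sees the location `l`. -/
def Sees {n : ℕ} (P : Polygon Plane n) (g : Set Plane) (l : Plane) : Prop :=
  ∃ p ∈ g, Visible P l p

/-- The guards `g₁` and `g₂` see each other. -/
def GuardsSeeEachOther {n : ℕ} (P : Polygon Plane n) (g₁ g₂ : Set Plane) : Prop :=
  ∃ p ∈ g₁, ∃ q ∈ g₂, Visible P p q

/-- `G` is a hidden open mobile guard set of `P`. -/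
structure IsHiddenOpenMobileGuardSet {n : ℕ} (P : Polygon Plane n)
    (G : Set (Set Plane)) : Prop where
  mobile : ∀ g ∈ G, IsOpenMobileGuard P g
  guards : ∀ l ∈ polyInterior P, ∃ g ∈ G, Sees P g l
  hidden : ∀ g₁ ∈ G, ∀ g₂ ∈ G, g₁ ≠ g₂ → ¬ GuardsSeeEachOther P g₁ g₂

/-- `P` admits a hidden open mobile guard set. -/
def AdmitsHiddenOpenMobileGuardSet {n : ℕ} (P : Polygon Plane n) : Prop :=
  ∃ G : Set (Set Plane), IsHiddenOpenMobileGuardSet P G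

/-- The length of a path in the plane. -/
noncomputable def pathLength {p q : Plane} (γ : Path p q) : ENNReal :=
  eVariationOn (fun t => γ t) Set.univ

/-- `γ` is a geodesic path from `p` to `q` in `P`: a shortest path among all continuous paths from
`p` to `q` inside the closed region of `P`. -/
def IsGeodesic {n : ℕ} (P : Polygon Plane n) {p q : Plane} (γ : Path p q) : Prop :=
  Set.range γ ⊆ region P ∧
    ∀ γ' : Path p q, Set.range γ' ⊆ region P → pathLength γ ≤ pathLength γ'

/-- The open edges of a geodesic path: the pieces (connected components) into which its trace is
cut by the vertices of `P`. -/
def openEdges {n : ℕ} (P : Polygon Plane n) {p q : Plane} (γ : Path p q) : Set (Set Plane) :=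
  {g | ∃ x ∈ Set.range γ \ Set.range P.vertices,
    g = connectedComponentIn (Set.range γ \ Set.range P.vertices) x}

end HiddenGuards

/-!
# Geodesic paths are hidden open mobile guard sets of monotone polygons

Let `P` be a simple polygon that is monotone in the direction `e`, and let `γ` be a shortest path in
the closed region from a leftmost to a rightmost vertex.

*The two sides of the boundary.* The full Jordan curve theorem is not needed. Turning around a
vertex, one sees that a side of an edge lies in the same component of the complement of the
boundary as the same side of the next edge (`IsSimple.sideIn_finRotate`). So one only has to look at
a single edge, and monotonicity provides one: the highest boundary point on a vertical line without
vertices has an unbounded ray above it, while the line meets the boundary again further down, so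
that the points right below belong to the region. Hence every edge has the outside on one side and
the interior on the other, consistently along the boundary (`IsSimple.exists_isOuterSign`).

*Open edges are guards.* It follows that the region is locally convex away from the vertices. A
geodesic path is straight wherever a straight shortcut exists (`IsGeodesic.mem_segment`), so outside
of the vertices its trace is locally a line (`IsGeodesic.isLocallyLine`), and the components are
open segments between vertices (`IsLocallyLine.connectedComponentIn_eq`). Such a segment cannot
cross an edge, which makes it an edge or a diagonal (`IsOuterSign.isOpenMobileGuard`).

*Hiddenness.* If two points of the path see each other, then the path follows their line of sight,
which contains no vertices, so both points lie on the same open edge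
(`IsGeodesic.mem_connectedComponentIn_of_visible`).

*Guarding.* In a vertical strip without vertices, the interior is convex, being bounded by just two
edges. So an interior point sees every point of the region slightly to its right, as long as no
vertex is in between (`IsOuterSign.openSegment_subset`). The path passes there by the intermediate
value theorem (`IsGeodesic.exists_sees`).

*Existence.* A curve with the least Lipschitz constant on the unit interval exists by Tychonoff's
theorem (`IsLipCurve.exists_min`), and it is a shortest path because every path of finite length can
be reparametrized proportionally to its length (`exists_isLipCurve_of_pathLength_le`).
-/

namespace HiddenGuards

open Filter Topology

variable {n : ℕ} {P : Polygon Plane n}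

/-! ### Topology of the interior and of the closed region -/

lemma edgeSet_eq_segment (P : Polygon Plane n) (i : Fin n) :
    P.edgeSet ℝ i = segment ℝ (P i) (P (finRotate n i)) :=
  affineSegment_eq_segment _ _ _

lemma edgeSet_subset_boundary (P : Polygon Plane n) (i : Fin n) :
    P.edgeSet ℝ i ⊆ P.boundary ℝ :=
  Set.subset_iUnion (fun i => P.edgeSet ℝ i) i

lemma openEdge_subset_boundary (P : Polygon Plane n) (i : Fin n) :
    openSegment ℝ (P i) (P (finRotate n i)) ⊆ P.boundary ℝ :=
  ((openSegment_subset_segment ℝ _ _).trans (edgeSet_eq_segment P i).ge).trans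
    (edgeSet_subset_boundary P i)

lemma mem_boundary_iff {x : Plane} :
    x ∈ P.boundary ℝ ↔ ∃ i, x ∈ segment ℝ (P i) (P (finRotate n i)) := by
  simp only [Polygon.boundary, Set.mem_iUnion, edgeSet_eq_segment]

lemma vertex_mem_boundary (P : Polygon Plane n) (i : Fin n) : P i ∈ P.boundary ℝ :=
  mem_boundary_iff.2 ⟨i, left_mem_segment ℝ _ _⟩

lemma isCompact_segment (a b : Plane) : IsCompact (segment ℝ a b) := by
  rw [segment_eq_image_lineMap]
  exact isCompact_Icc.image AffineMap.lineMap_continuous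

lemma isCompact_edgeSet (P : Polygon Plane n) (i : Fin n) : IsCompact (P.edgeSet ℝ i) := by
  rw [edgeSet_eq_segment]; exact isCompact_segment _ _

lemma isCompact_boundary (P : Polygon Plane n) : IsCompact (P.boundary ℝ) :=
  isCompact_iUnion (isCompact_edgeSet P)

lemma polyInterior_subset_region (P : Polygon Plane n) : polyInterior P ⊆ region P :=
  Set.subset_union_left

lemma mem_polyInterior_iff {x : Plane} : x ∈ polyInterior P ↔ x ∈ region P ∧ x ∉ P.boundary ℝ :=
  ⟨fun h => ⟨Or.inl h, h.1⟩, fun h => h.1.resolve_right h.2⟩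

/-- Off the boundary, `M` is a union of connected components of the complement of the boundary.
It is enough to test this on convex sets, as the complement of the boundary is open. -/
def IsSaturated (P : Polygon Plane n) (M : Set Plane) : Prop :=
  ∀ T : Set Plane, Convex ℝ T → T ⊆ (P.boundary ℝ)ᶜ → (T ∩ M).Nonempty → T ⊆ M

lemma connectedComponentIn_eq_of_convex {T : Set Plane} (hT : Convex ℝ T)
    (hTP : T ⊆ (P.boundary ℝ)ᶜ) {x y : Plane} (hx : x ∈ T) (hy : y ∈ T) :
    connectedComponentIn (P.boundary ℝ)ᶜ x = connectedComponentIn (P.boundary ℝ)ᶜ y :=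
  connectedComponentIn_eq (hT.isPreconnected.subset_connectedComponentIn hx hTP hy)

lemma isSaturated_polyInterior (P : Polygon Plane n) : IsSaturated P (polyInterior P) := by
  rintro T hT hTP ⟨x, hxT, hx⟩ y hy
  refine ⟨hTP hy, ?_⟩
  rw [← connectedComponentIn_eq_of_convex hT hTP hxT hy]
  exact hx.2

lemma isSaturated_compl_region (P : Polygon Plane n) : IsSaturated P (region P)ᶜ := by
  rintro T hT hTP ⟨x, hxT, hx⟩ y hy hyr
  have hyi : y ∈ polyInterior P := mem_polyInterior_iff.2 ⟨hyr, hTP hy⟩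
  exact hx (Or.inl (isSaturated_polyInterior P T hT hTP ⟨y, hy, hyi⟩ hxT))

lemma isOpen_polyInterior (P : Polygon Plane n) : IsOpen (polyInterior P) := by
  rw [Metric.isOpen_iff]
  intro x hx
  obtain ⟨r, hr, hrP⟩ := Metric.isOpen_iff.1 (isCompact_boundary P).isClosed.isOpen_compl x hx.1
  exact ⟨r, hr, isSaturated_polyInterior P _ (convex_ball x r) hrP
    ⟨x, Metric.mem_ball_self hr, hx⟩⟩

lemma isClosed_region (P : Polygon Plane n) : IsClosed (region P) := by
  rw [← isOpen_compl_iff, Metric.isOpen_iff]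
  intro x hx
  have hxb : x ∈ (P.boundary ℝ)ᶜ := fun h => hx (Or.inr h)
  obtain ⟨r, hr, hrP⟩ := Metric.isOpen_iff.1 (isCompact_boundary P).isClosed.isOpen_compl x hxb
  exact ⟨r, hr, isSaturated_compl_region P _ (convex_ball x r) hrP
    ⟨x, Metric.mem_ball_self hr, hx⟩⟩

/-- An unbounded convex set that avoids the boundary lies outside of the region. -/
lemma subset_compl_region_of_unbounded {T : Set Plane} (hT : Convex ℝ T)
    (hTP : T ⊆ (P.boundary ℝ)ᶜ) (hub : ¬ Bornology.IsBounded T) : T ⊆ (region P)ᶜ := by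
  intro x hx hxr
  have hxi : x ∈ polyInterior P := mem_polyInterior_iff.2 ⟨hxr, hTP hx⟩
  exact hub (hxi.2.subset (hT.isPreconnected.subset_connectedComponentIn hx hTP))

lemma not_isBounded_of_ray {T : Set Plane} {x w : Plane} (hw : w ≠ 0)
    (h : ∀ t : ℝ, 0 < t → x + t • w ∈ T) : ¬ Bornology.IsBounded T := by
  intro hb
  obtain ⟨C, hC⟩ := hb.subset_closedBall x
  have hC0 : 0 < ‖w‖ := norm_pos_iff.2 hw
  have h1 := hC (h ((|C| + 1) / ‖w‖) (by positivity))
  rw [Metric.mem_closedBall, dist_eq_norm, add_sub_cancel_left, norm_smul, Real.norm_of_nonneg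
    (by positivity), div_mul_cancel₀ _ hC0.ne'] at h1
  linarith [le_abs_self C]

lemma inner_le_of_mem_segment {w a b z : Plane} {M : ℝ} (ha : inner ℝ w a ≤ M)
    (hb : inner ℝ w b ≤ M) (hz : z ∈ segment ℝ a b) : inner ℝ w z ≤ M := by
  obtain ⟨s, t, hs, ht, hst, rfl⟩ := hz
  rw [inner_add_right, inner_smul_right, inner_smul_right]
  calc s * inner ℝ w a + t * inner ℝ w b ≤ s * M + t * M := by gcongr
    _ = M := by rw [← add_mul, hst, one_mul]

/-- The region lies in every half-plane that contains the vertices, since the complementary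
half-plane is unbounded. -/
lemma inner_le_of_mem_region {w : Plane} {M : ℝ} (hw : w ≠ 0) (h : ∀ k, inner ℝ w (P k) ≤ M)
    {z : Plane} (hz : z ∈ region P) : inner ℝ w z ≤ M := by
  by_contra! hlt
  have hsub : {y : Plane | M < inner ℝ w y} ⊆ (P.boundary ℝ)ᶜ := by
    intro y hy hyb
    obtain ⟨i, hi⟩ := mem_boundary_iff.1 hyb
    exact (inner_le_of_mem_segment (h _) (h _) hi).not_gt hy
  refine subset_compl_region_of_unbounded ?_ hsub
    (not_isBounded_of_ray (x := z) (w := w) hw ?_) hlt hz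
  · exact convex_halfSpace_gt (innerₗ Plane w).isLinear M
  · intro t ht
    have : (0:ℝ) ≤ t * inner ℝ w w := mul_nonneg ht.le real_inner_self_nonneg
    simp only [Set.mem_ofPred_eq, inner_add_right, inner_smul_right]
    linarith

lemma isCompact_region (P : Polygon Plane n) : IsCompact (region P) := by
  refine Metric.isCompact_of_isClosed_isBounded (isClosed_region P) ?_
  obtain ⟨C, hC0, hC⟩ := (isCompact_boundary P).isBounded.exists_pos_norm_le
  have key : ∀ w : Plane, ‖w‖ = 1 → ∀ z ∈ region P, inner ℝ w z ≤ C := by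
    intro w hw z hz
    refine inner_le_of_mem_region (norm_ne_zero_iff.1 (by simp [hw])) (fun k => ?_) hz
    refine (real_inner_le_norm _ _).trans ?_
    rw [hw, one_mul]
    exact hC _ (vertex_mem_boundary P k)
  rw [isBounded_iff_forall_norm_le]
  refine ⟨C, fun z hz => ?_⟩
  -- testing with the direction of `z` itself bounds the norm
  rcases eq_or_ne z 0 with rfl | h0
  · simpa using hC0.le
  · have h1 := key ((‖z‖)⁻¹ • z) (by
      rw [norm_smul, norm_inv, norm_norm, inv_mul_cancel₀ (norm_ne_zero_iff.2 h0)]) z hz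
    rw [real_inner_smul_left, real_inner_self_eq_norm_sq] at h1
    have h2 : ‖z‖ ≠ 0 := norm_ne_zero_iff.2 h0
    have : ‖z‖⁻¹ * ‖z‖ ^ 2 = ‖z‖ := by field_simp
    linarith

/-! ### Edges and vertices of a simple polygon -/

lemma IsSimple.vertex_mem_edge (hP : IsSimple P) {k i : Fin n}
    (h : P k ∈ segment ℝ (P i) (P (finRotate n i))) : k = i ∨ k = finRotate n i := by
  by_contra! hk
  rw [← edgeSet_eq_segment] at h
  have hk' : P k ∈ P.edgeSet ℝ k := by
    rw [edgeSet_eq_segment]; exact left_mem_segment ℝ _ _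
  by_cases hik : i = finRotate n k
  · subst hik
    have h1 : P k ∈ P.edgeSet ℝ k ∩ P.edgeSet ℝ (finRotate n k) := ⟨hk', h⟩
    rw [hP.consecutive k] at h1
    exact hP.nondegenerate k h1
  · exact Set.disjoint_left.1 (hP.disjoint i k (Ne.symm hk.1) hk.2 hik) h hk'

lemma IsSimple.injective (hP : IsSimple P) : Function.Injective P.vertices := by
  intro k i h
  have h' : P k = P i := h
  rcases hP.vertex_mem_edge (k := k) (i := i) (h' ▸ left_mem_segment ℝ _ _) with h1 | h1
  · exact h1
  · subst h1; exact absurd h'.symm (hP.nondegenerate i)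

lemma IsSimple.vertex_notMem_openEdge (hP : IsSimple P) (k i : Fin n) :
    P k ∉ openSegment ℝ (P i) (P (finRotate n i)) := by
  intro h
  have hne := hP.nondegenerate i
  rcases hP.vertex_mem_edge (openSegment_subset_segment ℝ _ _ h) with h1 | h1
  · subst h1; exact hne (left_mem_openSegment_iff.1 h)
  · subst h1; exact hne (right_mem_openSegment_iff.1 h)

lemma mem_openSegment_of_mem_segment {a b z : Plane} (h : z ∈ segment ℝ a b) (ha : z ≠ a)
    (hb : z ≠ b) : z ∈ openSegment ℝ a b :=
  mem_openSegment_of_ne_left_right ha.symm hb.symm h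

lemma mem_openEdge_of_mem_boundary {z : Plane} (h : z ∈ P.boundary ℝ)
    (hz : z ∉ Set.range P.vertices) : ∃ i, z ∈ openSegment ℝ (P i) (P (finRotate n i)) := by
  obtain ⟨i, hi⟩ := mem_boundary_iff.1 h
  exact ⟨i, mem_openSegment_of_mem_segment hi (fun h => hz ⟨i, h.symm⟩)
    (fun h => hz ⟨_, h.symm⟩)⟩

/-- Distinct edges have at most vertices in common. -/
lemma IsSimple.eq_of_mem_openEdge_of_mem_edge (hP : IsSimple P) {i k : Fin n} {z : Plane}
    (hi : z ∈ openSegment ℝ (P i) (P (finRotate n i)))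
    (hk : z ∈ segment ℝ (P k) (P (finRotate n k))) : i = k := by
  by_contra hik
  have hi' := openSegment_subset_segment ℝ _ _ hi
  rw [← edgeSet_eq_segment] at hi' hk
  by_cases h1 : k = finRotate n i
  · subst h1
    have : z ∈ P.edgeSet ℝ i ∩ P.edgeSet ℝ (finRotate n i) := ⟨hi', hk⟩
    rw [hP.consecutive i] at this
    exact hP.vertex_notMem_openEdge (finRotate n i) i (this ▸ hi)
  · by_cases h2 : i = finRotate n k
    · subst h2
      have : z ∈ P.edgeSet ℝ k ∩ P.edgeSet ℝ (finRotate n k) := ⟨hk, hi'⟩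
      rw [hP.consecutive k] at this
      exact hP.vertex_notMem_openEdge (finRotate n k) _ (this ▸ hi)
    · exact Set.disjoint_left.1 (hP.disjoint i k hik h1 h2) hi' hk

/-- A property of edges that passes from each edge to the next holds for all edges as soon as it
holds for one. -/
lemma forall_of_forall_finRotate {p : Fin n → Prop} (h : ∀ i, p i → p (finRotate n i)) {i : Fin n}
    (hi : p i) (j : Fin n) : p j := by
  rcases Nat.lt_or_ge n 2 with hn | hn
  · have : Subsingleton (Fin n) := Fin.subsingleton_iff_le_one.2 (by omega)
    rwa [Subsingleton.elim j i]
  · have hs := support_finRotate_of_le hn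
    have hc := isCycle_finRotate_of_le hn
    have hi' : finRotate n i ≠ i := by
      rw [← Equiv.Perm.mem_support, hs]; exact Finset.mem_univ _
    have hj' : finRotate n j ≠ j := by
      rw [← Equiv.Perm.mem_support, hs]; exact Finset.mem_univ _
    obtain ⟨k, hk⟩ := hc.exists_pow_eq hi' hj'
    have : ∀ k : ℕ, p (((finRotate n) ^ k) i) := by
      intro k
      induction k with
      | zero => simpa using hi
      | succ k ih => rw [pow_succ', Equiv.Perm.mul_apply]; exact h _ ih
    exact hk ▸ this k

/-- The union of all edges but the `i`-th, which is closed. -/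
def otherEdges (P : Polygon Plane n) (i : Fin n) : Set Plane :=
  ⋃ k ∈ {k : Fin n | k ≠ i}, P.edgeSet ℝ k

lemma isClosed_otherEdges (P : Polygon Plane n) (i : Fin n) : IsClosed (otherEdges P i) :=
  (Set.toFinite _).isClosed_biUnion fun k _ => (isCompact_edgeSet P k).isClosed

lemma mem_edge_or_otherEdges {z : Plane} (h : z ∈ P.boundary ℝ) (i : Fin n) :
    z ∈ segment ℝ (P i) (P (finRotate n i)) ∨ z ∈ otherEdges P i := by
  obtain ⟨k, hk⟩ := mem_boundary_iff.1 h
  by_cases hki : k = i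
  · left; rwa [hki] at hk
  · right
    rw [← edgeSet_eq_segment] at hk
    exact Set.mem_biUnion (show k ∈ {k : Fin n | k ≠ i} from hki) hk

lemma IsSimple.disjoint_openEdge_otherEdges (hP : IsSimple P) (i : Fin n) :
    Disjoint (openSegment ℝ (P i) (P (finRotate n i))) (otherEdges P i) := by
  rw [Set.disjoint_left]
  intro z hz hzo
  obtain ⟨k, hki, hk⟩ := Set.mem_iUnion₂.1 hzo
  rw [edgeSet_eq_segment] at hk
  exact hki (hP.eq_of_mem_openEdge_of_mem_edge hz hk).symm

/-! ### Cross products and sides of edges -/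

/-- The cross product of two plane vectors. -/
def cross (u v : Plane) : ℝ := u 0 * v 1 - u 1 * v 0

/-- The rotation of a plane vector by a quarter turn counterclockwise. -/
def perp (u : Plane) : Plane := !₂[-u 1, u 0]

@[simp] lemma perp_zero_apply (u : Plane) : perp u 0 = -u 1 := rfl
@[simp] lemma perp_one_apply (u : Plane) : perp u 1 = u 0 := rfl

lemma cross_add_right (u v w : Plane) : cross u (v + w) = cross u v + cross u w := by
  simp only [cross, PiLp.add_apply]; ring

lemma cross_sub_right (u v w : Plane) : cross u (v - w) = cross u v - cross u w := by
  simp only [cross, PiLp.sub_apply]; ring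

lemma cross_smul_right (u v : Plane) (t : ℝ) : cross u (t • v) = t * cross u v := by
  simp only [cross, PiLp.smul_apply, smul_eq_mul]; ring

lemma cross_smul_left (u v : Plane) (t : ℝ) : cross (t • u) v = t * cross u v := by
  simp only [cross, PiLp.smul_apply, smul_eq_mul]; ring

@[simp] lemma cross_self (u : Plane) : cross u u = 0 := by simp only [cross]; ring

lemma cross_swap (u v : Plane) : cross v u = -cross u v := by simp only [cross]; ring

lemma inner_eq (u v : Plane) : inner ℝ u v = u 0 * v 0 + u 1 * v 1 := by
  simp only [PiLp.inner_apply, Fin.sum_univ_two, RCLike.inner_apply, conj_trivial]; ring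

lemma cross_perp (u : Plane) : cross u (perp u) = inner ℝ u u := by
  rw [inner_eq]; simp only [cross, perp_zero_apply, perp_one_apply]; ring

lemma inner_perp (u : Plane) : inner ℝ u (perp u) = 0 := by
  rw [inner_eq, perp_zero_apply, perp_one_apply]; ring

lemma cross_perp_pos {u : Plane} (hu : u ≠ 0) : 0 < cross u (perp u) := by
  rw [cross_perp]; exact real_inner_self_pos.2 hu

lemma continuous_cross (u : Plane) : Continuous (cross u) := by
  unfold cross; fun_prop

/-- Parallel vectors are multiples of each other. -/
lemma exists_smul_of_cross_eq_zero {u v : Plane} (hu : u ≠ 0) (h : cross u v = 0) :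
    ∃ t : ℝ, v = t • u := by
  have hpos : 0 < inner ℝ u u := real_inner_self_pos.2 hu
  refine ⟨inner ℝ u v / inner ℝ u u, ?_⟩
  ext k
  rw [PiLp.smul_apply, smul_eq_mul, div_mul_eq_mul_div, eq_div_iff hpos.ne']
  simp only [inner_eq, cross] at h ⊢
  fin_cases k
  · simp only [Fin.zero_eta]
    linear_combination -u 1 * h
  · simp only [Fin.mk_one]
    linear_combination u 0 * h

/-- The position of `z` relative to the line through the `i`-th edge: positive to the left of the
edge, negative to the right of it. -/
def side (P : Polygon Plane n) (i : Fin n) (z : Plane) : ℝ :=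
  cross (P (finRotate n i) - P i) (z - P i)

lemma continuous_side (P : Polygon Plane n) (i : Fin n) : Continuous (side P i) :=
  (continuous_cross _).comp (by fun_prop)

lemma side_add (P : Polygon Plane n) (i : Fin n) (z v : Plane) :
    side P i (z + v) = side P i z + cross (P (finRotate n i) - P i) v := by
  rw [side, side, add_sub_right_comm, cross_add_right]

lemma side_comb (P : Polygon Plane n) (i : Fin n) (x y : Plane) {a b : ℝ} (hab : a + b = 1) :
    side P i (a • x + b • y) = a * side P i x + b * side P i y := by
  have : a • x + b • y - P i = a • (x - P i) + b • (y - P i) := by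
    rw [smul_sub, smul_sub]
    nth_rewrite 1 [← one_smul ℝ (P i), ← hab]
    rw [add_smul]; abel
  rw [side, this, cross_add_right, cross_smul_right, cross_smul_right, side, side]

@[simp] lemma side_left (P : Polygon Plane n) (i : Fin n) : side P i (P i) = 0 := by
  simp [side, cross]

@[simp] lemma side_right (P : Polygon Plane n) (i : Fin n) :
    side P i (P (finRotate n i)) = 0 := by
  simp [side]

lemma side_eq_zero_of_mem_edge {i : Fin n} {z : Plane}
    (h : z ∈ segment ℝ (P i) (P (finRotate n i))) : side P i z = 0 := by
  obtain ⟨a, b, -, -, hab, rfl⟩ := h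
  rw [side_comb P i _ _ hab, side_left, side_right, mul_zero, mul_zero, add_zero]

lemma convex_side_pos (P : Polygon Plane n) (i : Fin n) (σ : ℝ) :
    Convex ℝ {z | 0 < σ * side P i z} := by
  intro x hx y hy a b ha hb hab
  simp only [Set.mem_ofPred_eq] at hx hy ⊢
  rw [side_comb P i x y hab]
  have : 0 < a ∨ 0 < b := by
    by_contra! h; linarith
  rcases this with h | h
  · nlinarith [mul_pos h hx, mul_nonneg hb hy.le]
  · nlinarith [mul_pos h hy, mul_nonneg ha hx.le]

lemma isOpen_side_pos (P : Polygon Plane n) (i : Fin n) (σ : ℝ) :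
    IsOpen {z | 0 < σ * side P i z} :=
  isOpen_lt continuous_const ((continuous_side P i).const_mul σ)

/-! ### Walking along the boundary -/

/-- Along the whole `i`-th edge, the points close to the edge on the side with sign `σ` belong
to `M`. -/
def SideIn (P : Polygon Plane n) (M : Set Plane) (i : Fin n) (σ : ℝ) : Prop :=
  ∀ x ∈ openSegment ℝ (P i) (P (finRotate n i)), ∃ r > 0, ∀ z ∈ Metric.ball x r,
    0 < σ * side P i z → z ∈ M

/-- If `M` contains points of one side arbitrarily close to a single point of an edge, then it
contains that side along the whole edge: any two points of the edge lie in a tube around the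
edge whose half is convex and avoids the boundary. -/
lemma IsSimple.sideIn_of_frequently (hP : IsSimple P) {M : Set Plane} (hM : IsSaturated P M)
    {i : Fin n} {σ : ℝ} {x : Plane} (hx : x ∈ openSegment ℝ (P i) (P (finRotate n i)))
    (h : ∀ r > 0, ∃ z ∈ Metric.ball x r, 0 < σ * side P i z ∧ z ∈ M) : SideIn P M i σ := by
  intro y hy
  have hsub : segment ℝ x y ⊆ openSegment ℝ (P i) (P (finRotate n i)) :=
    (convex_openSegment _ _).segment_subset hx hy
  obtain ⟨δ, hδ, hdisj⟩ := ((hP.disjoint_openEdge_otherEdges i).mono_left hsub).exists_thickenings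
    (isCompact_segment x y) (isClosed_otherEdges P i)
  have hT : Convex ℝ (Metric.thickening δ (segment ℝ x y) ∩ {z | 0 < σ * side P i z}) :=
    ((convex_segment x y).thickening δ).inter (convex_side_pos P i σ)
  have hTP : Metric.thickening δ (segment ℝ x y) ∩ {z | 0 < σ * side P i z} ⊆
      (P.boundary ℝ)ᶜ := by
    rintro z ⟨hz1, hz2⟩ hzb
    rcases mem_edge_or_otherEdges hzb i with h1 | h1
    · simp [side_eq_zero_of_mem_edge h1] at hz2
    · exact Set.disjoint_left.1 hdisj hz1 (Metric.self_subset_thickening hδ _ h1)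
  have hball : ∀ w ∈ segment ℝ x y, Metric.ball w δ ⊆ Metric.thickening δ (segment ℝ x y) :=
    fun w hw => Metric.ball_subset_thickening hw δ
  obtain ⟨z, hz, hzs, hzM⟩ := h δ hδ
  have hTM := hM _ hT hTP ⟨z, ⟨hball x (left_mem_segment ℝ x y) hz, hzs⟩, hzM⟩
  exact ⟨δ, hδ, fun z hz hzs => hTM ⟨hball y (right_mem_segment ℝ x y) hz, hzs⟩⟩

lemma exists_forall_add_smul_mem {O : Set Plane} (hO : IsOpen O) {x : Plane} (hx : x ∈ O)
    (w : Plane) : ∃ t₀ > 0, ∀ t : ℝ, 0 < t → t < t₀ → x + t • w ∈ O := by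
  have hc : Continuous fun t : ℝ => x + t • w := by fun_prop
  obtain ⟨r, hr, h⟩ := Metric.isOpen_iff.1 (hO.preimage hc) 0 (by simpa using hx)
  refine ⟨r, hr, fun t h0 ht => h ?_⟩
  rwa [Metric.mem_ball, Real.dist_eq, sub_zero, abs_of_pos h0]

lemma add_smul_sub_mem_openSegment (a b : Plane) {s : ℝ} (h0 : 0 < s) (h1 : s < 1) :
    a + s • (b - a) ∈ openSegment ℝ a b := by
  refine ⟨1 - s, s, by linarith, h0, by ring, ?_⟩
  rw [sub_smul, one_smul, smul_sub]; abel

/-- Every neighbourhood of a point `x` of the supporting line of an edge has points on either side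
of that line. -/
lemma IsSimple.exists_mem_side_pos (hP : IsSimple P) {O : Set Plane} (hO : IsOpen O) {x : Plane}
    (hx : x ∈ O) {i : Fin n} (hs : side P i x = 0) {σ : ℝ} (hσ : σ ≠ 0) :
    ∃ z ∈ O, 0 < σ * side P i z := by
  obtain ⟨t, ht, h⟩ := exists_forall_add_smul_mem hO hx
    (σ • perp (P (finRotate n i) - P i))
  refine ⟨_, h (t / 2) (by linarith) (by linarith), ?_⟩
  have := cross_perp_pos (sub_ne_zero.2 (hP.nondegenerate i).symm)
  rw [side_add, hs, cross_smul_right, cross_smul_right, zero_add]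
  have h2 : 0 < σ * σ := mul_self_pos.2 hσ
  have : 0 < (t / 2) * ((σ * σ) * cross (P (finRotate n i) - P i)
    (perp (P (finRotate n i) - P i))) := by positivity
  linarith

/-- Close to a vertex, the boundary consists of the two edges at this vertex. -/
lemma IsSimple.exists_ball_vertex (hP : IsSimple P) (i : Fin n) : ∃ r > 0,
    ∀ z ∈ Metric.ball (P (finRotate n i)) r, z ∈ P.boundary ℝ →
      z ∈ segment ℝ (P i) (P (finRotate n i)) ∨
      z ∈ segment ℝ (P (finRotate n i)) (P (finRotate n (finRotate n i))) := by
  have hcl : IsClosed (⋃ k ∈ {k : Fin n | k ≠ i ∧ k ≠ finRotate n i}, P.edgeSet ℝ k) :=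
    (Set.toFinite _).isClosed_biUnion fun k _ => (isCompact_edgeSet P k).isClosed
  have hw : P (finRotate n i) ∈ (⋃ k ∈ {k : Fin n | k ≠ i ∧ k ≠ finRotate n i},
      P.edgeSet ℝ k)ᶜ := by
    intro h
    obtain ⟨k, hk, h⟩ := Set.mem_iUnion₂.1 h
    rw [edgeSet_eq_segment] at h
    rcases hP.vertex_mem_edge h with h1 | h1
    · exact hk.2 h1.symm
    · exact hk.1 ((finRotate n).injective h1).symm
  obtain ⟨r, hr, h⟩ := Metric.isOpen_iff.1 hcl.isOpen_compl _ hw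
  refine ⟨r, hr, fun z hz hzb => ?_⟩
  obtain ⟨k, hk⟩ := mem_boundary_iff.1 hzb
  by_cases h1 : k = i
  · left; rwa [h1] at hk
  by_cases h2 : k = finRotate n i
  · right; rwa [h2] at hk
  refine absurd (Set.mem_biUnion (show k ∈ {k : Fin n | k ≠ i ∧ k ≠ finRotate n i} from ⟨h1, h2⟩)
    ?_) (h hz)
  rwa [edgeSet_eq_segment]

/-- Two consecutive edges do not fold back onto each other. -/
lemma IsSimple.exists_pos_smul_of_cross_eq_zero (hP : IsSimple P) (i : Fin n)
    (h : cross (P (finRotate n i) - P i) (P (finRotate n (finRotate n i)) - P (finRotate n i)) =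
      0) :
    ∃ μ : ℝ, 0 < μ ∧
      P (finRotate n (finRotate n i)) - P (finRotate n i) = μ • (P (finRotate n i) - P i) := by
  obtain ⟨μ, hμ⟩ := exists_smul_of_cross_eq_zero (sub_ne_zero.2 (hP.nondegenerate i).symm) h
  refine ⟨μ, ?_, hμ⟩
  by_contra! hneg
  have hne := sub_ne_zero.2 (hP.nondegenerate (finRotate n i)).symm
  have hneg' : μ < 0 := lt_of_le_of_ne hneg (by rintro rfl; exact hne (by simpa using hμ))
  -- for small `s > 0`, the following point would belong to both edges
  set s : ℝ := min (1 / 2) (1 / (2 * (-μ))) with hs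
  have hs0 : 0 < s := lt_min (by norm_num) (by apply div_pos one_pos; linarith)
  have hs1 : s < 1 := (min_le_left _ _).trans_lt (by norm_num)
  have hs2 : s * (-μ) < 1 := by
    have : s ≤ 1 / (2 * (-μ)) := min_le_right _ _
    have h2 : 1 / (2 * (-μ)) * (-μ) = 1 / 2 := by
      have : μ ≠ 0 := hneg'.ne
      field_simp
    nlinarith
  have h1 := add_smul_sub_mem_openSegment (P (finRotate n i))
    (P (finRotate n (finRotate n i))) hs0 hs1
  have h2 : P (finRotate n i) + s • (P (finRotate n (finRotate n i)) - P (finRotate n i)) ∈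
      openSegment ℝ (P i) (P (finRotate n i)) := by
    have := add_smul_sub_mem_openSegment (P (finRotate n i)) (P i)
      (mul_pos hs0 (neg_pos.2 hneg')) hs2
    rw [openSegment_symm, hμ]
    convert this using 2
    rw [← neg_sub (P i), smul_neg, ← neg_smul, smul_smul]
  have := hP.eq_of_mem_openEdge_of_mem_edge h2 (openSegment_subset_segment ℝ _ _ h1)
  exact hP.nondegenerate i (congrArg P.vertices this)

/-- Turning around a vertex: a side of an edge is connected to the same side of the next edge
within a small disc around the common vertex. -/
lemma IsSimple.sideIn_finRotate (hP : IsSimple P) {M : Set Plane} (hM : IsSaturated P M)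
    {i : Fin n} {σ : ℝ} (hσ : σ ≠ 0) (h : SideIn P M i σ) : SideIn P M (finRotate n i) σ := by
  obtain ⟨r, hr, hball⟩ := hP.exists_ball_vertex i
  set q := finRotate n i with hq
  set w := P q with hw
  set d := w - P i with hd
  set b := P (finRotate n q) - w with hb
  have hd0 : d ≠ 0 := sub_ne_zero.2 (hP.nondegenerate i).symm
  have hsi : ∀ v, side P i (w + v) = cross d v := fun v => by
    rw [side_add, side_right, zero_add]
  have hsq : ∀ v, side P q (w + v) = cross b v := fun v => by
    rw [side_add, side_left, zero_add]
  have hrev : ∀ s : ℝ, w + s • (P i - w) = w + (-s) • d := fun s => by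
    rw [hd, ← neg_sub w (P i), smul_neg, neg_smul]
  -- points of the two edges inside the disc
  obtain ⟨t₁, ht₁, hx₁⟩ := exists_forall_add_smul_mem Metric.isOpen_ball
    (Metric.mem_ball_self hr : w ∈ Metric.ball w r) (P i - w)
  obtain ⟨t₂, ht₂, hx₂⟩ := exists_forall_add_smul_mem Metric.isOpen_ball
    (Metric.mem_ball_self hr : w ∈ Metric.ball w r) b
  obtain ⟨s, hs0, hs1, hst₁, hst₂⟩ : ∃ s : ℝ, 0 < s ∧ s < 1 ∧ s < t₁ ∧ s < t₂ := by
    obtain ⟨s, hs, hs'⟩ := exists_between (lt_min one_pos (lt_min ht₁ ht₂))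
    exact ⟨s, hs, hs'.trans_le (min_le_left _ _),
      hs'.trans_le ((min_le_right _ _).trans (min_le_left _ _)),
      hs'.trans_le ((min_le_right _ _).trans (min_le_right _ _))⟩
  have hxe : w + s • (P i - w) ∈ openSegment ℝ (P i) w := by
    rw [openSegment_symm]; exact add_smul_sub_mem_openSegment _ _ hs0 hs1
  have hye : w + s • b ∈ openSegment ℝ w (P (finRotate n q)) :=
    add_smul_sub_mem_openSegment _ _ hs0 hs1
  have hxb := hx₁ s hs0 hst₁
  have hyb := hx₂ s hs0 hst₂
  obtain ⟨r₁, hr₁, hM₁⟩ := h _ hxe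
  have hxs : side P i (w + s • (P i - w)) = 0 :=
    side_eq_zero_of_mem_edge (openSegment_subset_segment ℝ _ _ hxe)
  have hys : side P q (w + s • b) = 0 :=
    side_eq_zero_of_mem_edge (openSegment_subset_segment ℝ _ _ hye)
  have hedge₁ : ∀ z ∈ segment ℝ (P i) w, ∃ t : ℝ, 0 ≤ t ∧ z = w + (-t) • d := by
    intro z hz
    rw [segment_symm, segment_eq_image'] at hz
    obtain ⟨t, ht, rfl⟩ := hz
    exact ⟨t, ht.1, hrev t⟩
  have hedge₂ : ∀ z ∈ segment ℝ w (P (finRotate n q)), ∃ t : ℝ, 0 ≤ t ∧ z = w + t • b := by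
    intro z hz
    rw [segment_eq_image'] at hz
    obtain ⟨t, ht, rfl⟩ := hz
    exact ⟨t, ht.1, rfl⟩
  have hA : IsOpen {z | 0 < σ * side P i z} := isOpen_side_pos P i σ
  have hB : IsOpen {z | 0 < σ * side P q z} := isOpen_side_pos P q σ
  refine hP.sideIn_of_frequently hM hye fun r₂ hr₂ => ?_
  rcases lt_or_ge 0 (σ * cross d b) with hκ | hκ
  · -- the sector is convex, the intersection of two half-discs
    have hKP : Metric.ball w r ∩ ({z | 0 < σ * side P i z} ∩ {z | 0 < σ * side P q z}) ⊆
        (P.boundary ℝ)ᶜ := by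
      rintro z ⟨hzb, hzi, hzq⟩ hz
      rcases hball z hzb hz with h1 | h1
      · simp [side_eq_zero_of_mem_edge h1] at hzi
      · simp [side_eq_zero_of_mem_edge h1] at hzq
    have hK := hM _ ((convex_ball w r).inter ((convex_side_pos P i σ).inter
      (convex_side_pos P q σ))) hKP
    have hxq : w + s • (P i - w) ∈ {z | 0 < σ * side P q z} := by
      rw [Set.mem_ofPred_eq, hrev, hsq, cross_smul_right, cross_swap]
      nlinarith [mul_pos hs0 hκ]
    obtain ⟨z, ⟨⟨hz1, hz2⟩, hz3⟩, hz4⟩ := hP.exists_mem_side_pos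
      ((Metric.isOpen_ball.inter Metric.isOpen_ball).inter hB)
      (show w + s • (P i - w) ∈ (Metric.ball w r ∩ Metric.ball (w + s • (P i - w)) r₁) ∩
        {z | 0 < σ * side P q z} from ⟨⟨hxb, Metric.mem_ball_self hr₁⟩, hxq⟩) hxs hσ
    have hKM := hK ⟨z, ⟨hz1, hz4, hz3⟩, hM₁ z hz2 hz4⟩
    have hyi : w + s • b ∈ {z | 0 < σ * side P i z} := by
      rw [Set.mem_ofPred_eq, hsi, cross_smul_right]
      nlinarith [mul_pos hs0 hκ]
    obtain ⟨z, ⟨⟨hz1, hz2⟩, hz3⟩, hz4⟩ := hP.exists_mem_side_pos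
      ((Metric.isOpen_ball.inter Metric.isOpen_ball).inter hA)
      (show w + s • b ∈ (Metric.ball w r ∩ Metric.ball (w + s • b) r₂) ∩
        {z | 0 < σ * side P i z} from ⟨⟨hyb, Metric.mem_ball_self hr₂⟩, hyi⟩) hys hσ
    exact ⟨z, hz2, hz4, hKM ⟨hz1, hz3, hz4⟩⟩
  · -- the sector is the union of two overlapping half-discs
    have hKP₁ : Metric.ball w r ∩ {z | 0 < σ * side P i z} ⊆ (P.boundary ℝ)ᶜ := by
      rintro z ⟨hzb, hzi⟩ hz
      rcases hball z hzb hz with h1 | h1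
      · simp [side_eq_zero_of_mem_edge h1] at hzi
      · obtain ⟨t, ht, rfl⟩ := hedge₂ z h1
        rw [Set.mem_ofPred_eq, hsi, cross_smul_right] at hzi
        nlinarith [mul_nonneg ht (neg_nonneg.2 hκ)]
    have hKP₂ : Metric.ball w r ∩ {z | 0 < σ * side P q z} ⊆ (P.boundary ℝ)ᶜ := by
      rintro z ⟨hzb, hzq⟩ hz
      rcases hball z hzb hz with h1 | h1
      · obtain ⟨t, ht, rfl⟩ := hedge₁ z h1
        rw [Set.mem_ofPred_eq, hsq, cross_smul_right, cross_swap] at hzq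
        nlinarith [mul_nonneg ht (neg_nonneg.2 hκ)]
      · simp [side_eq_zero_of_mem_edge h1] at hzq
    have hK₁ := hM _ ((convex_ball w r).inter (convex_side_pos P i σ)) hKP₁
    have hK₂ := hM _ ((convex_ball w r).inter (convex_side_pos P q σ)) hKP₂
    obtain ⟨z, ⟨hz1, hz2⟩, hz4⟩ := hP.exists_mem_side_pos
      (Metric.isOpen_ball.inter Metric.isOpen_ball)
      (show w + s • (P i - w) ∈ Metric.ball w r ∩ Metric.ball (w + s • (P i - w)) r₁
        from ⟨hxb, Metric.mem_ball_self hr₁⟩) hxs hσ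
    have hKM₁ := hK₁ ⟨z, ⟨hz1, hz4⟩, hM₁ z hz2 hz4⟩
    -- a direction pointing into both half-discs
    obtain ⟨v, hv₁, hv₂⟩ : ∃ v, 0 < σ * cross d v ∧ 0 < σ * cross b v := by
      rcases hκ.lt_or_eq with h1 | h1
      · refine ⟨d - b, ?_, ?_⟩
        · rw [cross_sub_right, cross_self]; linarith
        · rw [cross_sub_right, cross_self, cross_swap]; linarith
      · have h2 : cross d b = 0 := (mul_eq_zero.1 h1).resolve_left hσ
        obtain ⟨μ, hμ, hbd⟩ := hP.exists_pos_smul_of_cross_eq_zero i h2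
        have h3 : 0 < σ * (σ * cross d (perp d)) := by
          rw [← mul_assoc]; exact mul_pos (mul_self_pos.2 hσ) (cross_perp_pos hd0)
        have hbd' : b = μ • d := hbd
        refine ⟨σ • perp d, by rwa [cross_smul_right], ?_⟩
        rw [hbd', cross_smul_left, cross_smul_right]
        nlinarith [mul_pos hμ h3]
    obtain ⟨t, ht, hv⟩ := exists_forall_add_smul_mem Metric.isOpen_ball
      (Metric.mem_ball_self hr : w ∈ Metric.ball w r) v
    have hvb := hv (t / 2) (by linarith) (by linarith)
    have hKM₂ := hK₂ ⟨w + (t / 2) • v, ⟨hvb, by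
      rw [Set.mem_ofPred_eq, hsq, cross_smul_right]; nlinarith [mul_pos ht hv₂]⟩,
      hKM₁ ⟨hvb, by
      rw [Set.mem_ofPred_eq, hsi, cross_smul_right]; nlinarith [mul_pos ht hv₁]⟩⟩
    obtain ⟨z, ⟨hz1, hz2⟩, hz4⟩ := hP.exists_mem_side_pos
      (Metric.isOpen_ball.inter Metric.isOpen_ball)
      (show w + s • b ∈ Metric.ball w r ∩ Metric.ball (w + s • b) r₂
        from ⟨hyb, Metric.mem_ball_self hr₂⟩) hys hσ
    exact ⟨z, hz2, hz4, hKM₂ ⟨hz1, hz4⟩⟩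

lemma IsSimple.sideIn_all (hP : IsSimple P) {M : Set Plane} (hM : IsSaturated P M)
    {i : Fin n} {σ : ℝ} (hσ : σ ≠ 0) (h : SideIn P M i σ) (j : Fin n) : SideIn P M j σ :=
  forall_of_forall_finRotate (p := fun i => SideIn P M i σ)
    (fun _ hi => hP.sideIn_finRotate hM hσ hi) h j

/-! ### Monotone polygons -/

lemma cross_perp_right (u e : Plane) : cross u (perp e) = inner ℝ e u := by
  rw [inner_eq]; simp only [cross, perp_zero_apply, perp_one_apply]; ring

lemma cross_perp_left (e u : Plane) : cross (perp e) u = -inner ℝ e u := by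
  rw [inner_eq]; simp only [cross, perp_zero_apply, perp_one_apply]; ring

lemma perp_ne_zero {e : Plane} (he : e ≠ 0) : perp e ≠ 0 := by
  intro h
  have := cross_perp_pos he
  rw [h] at this
  simp [cross] at this

lemma exists_eq_add_smul_perp {e x z : Plane} (he : e ≠ 0) (h : inner ℝ e x = inner ℝ e z) :
    ∃ t : ℝ, z = x + t • perp e := by
  obtain ⟨t, ht⟩ := exists_smul_of_cross_eq_zero (v := z - x) (perp_ne_zero he)
    (by rw [cross_perp_left, inner_sub_right, h, sub_self, neg_zero])
  exact ⟨t, by rw [← ht, add_sub_cancel]⟩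

/-- A connected subset of a vertical line contains the segment between any two of its points. -/
lemma IsMonotoneIn.segment_subset {e : Plane} (h : IsMonotoneIn P e) (he : e ≠ 0) {x z : Plane}
    (hx : x ∈ region P) (hz : z ∈ region P) (hxz : inner ℝ e x = inner ℝ e z) :
    segment ℝ x z ⊆ region P := by
  intro y hy
  have hcont : Continuous fun v : Plane => (inner ℝ (perp e) v : ℝ) := by fun_prop
  have hpc := (h (inner ℝ e x)).image _ hcont.continuousOn
  have hy1 : inner ℝ e y = inner ℝ e x := by
    obtain ⟨a, b, -, -, hab, rfl⟩ := hy
    rw [inner_add_right, inner_smul_right, inner_smul_right, ← hxz, ← add_mul, hab, one_mul]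
  have hy2 : inner ℝ (perp e) y ∈ segment ℝ (inner ℝ (perp e) x : ℝ) (inner ℝ (perp e) z) := by
    obtain ⟨a, b, ha, hb, hab, rfl⟩ := hy
    exact ⟨a, b, ha, hb, hab, by rw [inner_add_right, inner_smul_right, inner_smul_right]; rfl⟩
  rw [segment_eq_uIcc] at hy2
  obtain ⟨y', ⟨hy'r, hy'l⟩, hy'⟩ := hpc.ordConnected.uIcc_subset
    (Set.mem_image_of_mem _ ⟨hx, rfl⟩) (Set.mem_image_of_mem _ ⟨hz, hxz.symm⟩) hy2
  obtain ⟨t, rfl⟩ := exists_eq_add_smul_perp he (hy1.trans (Eq.symm hy'l))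
  have hne : (inner ℝ (perp e) (perp e) : ℝ) ≠ 0 :=
    (real_inner_self_pos.2 (perp_ne_zero he)).ne'
  simp only [inner_add_right, inner_smul_right] at hy'
  have ht : t = 0 := by
    have : t * inner ℝ (perp e) (perp e) = 0 := by linarith
    exact (mul_eq_zero.1 this).resolve_right hne
  simpa [ht] using hy'r

/-- A closed chain with vertices to the left of the line at height `c`, others to the right, and
none on the line has an edge crossing the line rightwards. -/
lemma exists_edge_crossing_right {e : Plane} {c : ℝ} {i j : Fin n} (hi : inner ℝ e (P i) < c)
    (hj : c < inner ℝ e (P j)) (hc : ∀ k, inner ℝ e (P k) ≠ c) :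
    ∃ k, inner ℝ e (P k) < c ∧ c < inner ℝ e (P (finRotate n k)) := by
  by_contra! h
  have := forall_of_forall_finRotate (p := fun k => inner ℝ e (P k) < c)
    (fun k hk => lt_of_le_of_ne (h k hk) (hc _)) hi j
  linarith

lemma exists_edge_crossing_left {e : Plane} {c : ℝ} {i j : Fin n} (hi : inner ℝ e (P i) < c)
    (hj : c < inner ℝ e (P j)) (hc : ∀ k, inner ℝ e (P k) ≠ c) :
    ∃ k, inner ℝ e (P (finRotate n k)) < c ∧ c < inner ℝ e (P k) := by
  by_contra! h
  have := forall_of_forall_finRotate (p := fun k => c < inner ℝ e (P k))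
    (fun k hk => by
      by_contra! h'
      exact (h k (lt_of_le_of_ne h' (hc _))).not_gt hk) hj i
  linarith

lemma exists_mem_openSegment_inner_eq {e a b : Plane} {c : ℝ} (ha : inner ℝ e a < c)
    (hb : c < inner ℝ e b) : ∃ z ∈ openSegment ℝ a b, inner ℝ e z = c := by
  have hpos : 0 < (inner ℝ e b : ℝ) - inner ℝ e a := by linarith
  refine ⟨_, add_smul_sub_mem_openSegment a b
    (s := (c - inner ℝ e a) / (inner ℝ e b - inner ℝ e a)) (div_pos (by linarith) hpos)
    ((div_lt_one hpos).2 (by linarith)), ?_⟩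
  rw [inner_add_right, inner_smul_right, inner_sub_right, div_mul_cancel₀ _ hpos.ne']
  ring

/-- An edge through a point of a line that contains no vertex is transversal to this line. -/
lemma inner_edge_ne_zero {e z : Plane} {i : Fin n}
    (hz : z ∈ segment ℝ (P i) (P (finRotate n i)))
    (hc : ∀ k, inner ℝ e (P k) ≠ inner ℝ e z) :
    inner ℝ e (P (finRotate n i) - P i) ≠ 0 := by
  intro h
  rw [segment_eq_image'] at hz
  obtain ⟨t, -, rfl⟩ := hz
  apply hc i
  rw [inner_add_right, inner_smul_right, h, mul_zero, add_zero]

lemma side_add_smul_perp (P : Polygon Plane n) (i : Fin n) {e x : Plane} (hx : side P i x = 0)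
    (t : ℝ) : side P i (x + t • perp e) = t * inner ℝ e (P (finRotate n i) - P i) := by
  rw [side_add, hx, cross_smul_right, cross_perp_right, zero_add]

lemma IsSimple.nonempty_fin (hP : IsSimple P) : Nonempty (Fin n) :=
  ⟨⟨0, by have := hP.three_le; omega⟩⟩

lemma IsSimple.exists_isLeftmost (hP : IsSimple P) (e : Plane) : ∃ i, IsLeftmost P e i :=
  have := hP.nonempty_fin
  Finite.exists_min fun k => (inner ℝ e (P k) : ℝ)

lemma IsSimple.exists_isRightmost (hP : IsSimple P) (e : Plane) : ∃ i, IsRightmost P e i :=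
  have := hP.nonempty_fin
  Finite.exists_max fun k => (inner ℝ e (P k) : ℝ)

lemma IsLeftmost.inner_le {e : Plane} (he : e ≠ 0) {i : Fin n} (hi : IsLeftmost P e i) {z : Plane}
    (hz : z ∈ region P) : inner ℝ e (P i) ≤ inner ℝ e z := by
  have := inner_le_of_mem_region (w := -e) (M := -inner ℝ e (P i)) (neg_ne_zero.2 he)
    (fun k => by rw [inner_neg_left]; exact neg_le_neg (hi k)) hz
  rw [inner_neg_left] at this
  linarith

/-- The vertices of a simple polygon are not all on one line: otherwise all edges would point in
the same direction. -/
lemma IsSimple.inner_lt_inner (hP : IsSimple P) {e : Plane} (he : e ≠ 0) {i j : Fin n}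
    (hi : IsLeftmost P e i) (hj : IsRightmost P e j) : inner ℝ e (P i) < inner ℝ e (P j) := by
  by_contra! hle
  have hall : ∀ k, inner ℝ e (P k) = inner ℝ e (P i) :=
    fun k => le_antisymm ((hj k).trans hle) (hi k)
  have hd : ∀ k, ∃ t : ℝ, P (finRotate n k) - P k = t • perp e := fun k => by
    obtain ⟨t, ht⟩ := exists_eq_add_smul_perp he ((hall k).trans (hall (finRotate n k)).symm)
    exact ⟨t, by rw [ht, add_sub_cancel_left]⟩
  set d := P (finRotate n i) - P i with hdi
  have hpos : ∀ k, 0 < (inner ℝ d (P (finRotate n k) - P k) : ℝ) := by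
    refine forall_of_forall_finRotate (i := i) (fun k hk => ?_) ?_
    · obtain ⟨s, hs⟩ := hd k
      obtain ⟨t, ht⟩ := hd (finRotate n k)
      obtain ⟨μ, hμ, h⟩ := hP.exists_pos_smul_of_cross_eq_zero k (by
        rw [hs, ht, cross_smul_left, cross_smul_right, cross_self, mul_zero, mul_zero])
      rw [h, inner_smul_right]
      exact mul_pos hμ hk
    · exact real_inner_self_pos.2 (sub_ne_zero.2 (hP.nondegenerate i).symm)
  obtain ⟨k, hk⟩ := hP.exists_isRightmost d
  have h1 := hpos k
  rw [inner_sub_right] at h1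
  linarith [hk (finRotate n k)]

/-- `σ` is the sign of the outer side of all edges: the points close to an edge on the side with
sign `σ` are outside of the region, and those on the other side are in the interior. -/
structure IsOuterSign (P : Polygon Plane n) (σ : ℝ) : Prop where
  ne_zero : σ ≠ 0
  outside : ∀ i, SideIn P (region P)ᶜ i σ
  inside : ∀ i, SideIn P (polyInterior P) i (-σ)

/-- In a monotone polygon, the highest boundary point on a vertical line without vertices has
the outside above and the interior below it. Walking along the boundary, the two sides of all the
other edges are of the same kind. -/
lemma IsSimple.exists_isOuterSign (hP : IsSimple P) {e : Plane} (he : e ≠ 0)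
    (h : IsMonotoneIn P e) : ∃ σ, IsOuterSign P σ := by
  obtain ⟨i₀, hi₀⟩ := hP.exists_isLeftmost e
  obtain ⟨j₀, hj₀⟩ := hP.exists_isRightmost e
  obtain ⟨c, ⟨hc1, hc2⟩, hc⟩ := ((Set.Ioo_infinite (hP.inner_lt_inner he hi₀ hj₀)).sdiff
    (Set.finite_range fun k => (inner ℝ e (P k) : ℝ))).nonempty
  have hcv : ∀ k, inner ℝ e (P k) ≠ c := fun k hk => hc ⟨k, hk⟩
  -- two points of the boundary on the line
  obtain ⟨k₁, hk₁, hk₁'⟩ := exists_edge_crossing_right hc1 hc2 hcv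
  obtain ⟨k₂, hk₂, hk₂'⟩ := exists_edge_crossing_left hc1 hc2 hcv
  obtain ⟨x₁, hx₁, hx₁c⟩ := exists_mem_openSegment_inner_eq hk₁ hk₁'
  obtain ⟨x₂, hx₂, hx₂c⟩ := exists_mem_openSegment_inner_eq hk₂ hk₂'
  rw [openSegment_symm] at hx₂
  have hx₁₂ : x₁ ≠ x₂ := by
    rintro rfl
    have := hP.eq_of_mem_openEdge_of_mem_edge hx₁ (openSegment_subset_segment ℝ _ _ hx₂)
    subst this
    linarith
  -- the highest boundary point on the line
  have hcpt : IsCompact (P.boundary ℝ ∩ crossLine e c) :=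
    (isCompact_boundary P).inter_right (isClosed_eq (by fun_prop) continuous_const)
  obtain ⟨x, ⟨hxb, hxc⟩, hmax⟩ := hcpt.exists_isMaxOn
    ⟨x₁, openEdge_subset_boundary P _ hx₁, hx₁c⟩
    (f := fun v : Plane => (inner ℝ (perp e) v : ℝ)) (by fun_prop)
  have hxc : inner ℝ e x = c := hxc
  have hxv : ∀ k, inner ℝ e (P k) ≠ inner ℝ e x := fun k => hxc ▸ hcv k
  obtain ⟨i, hi⟩ := mem_openEdge_of_mem_boundary hxb (by
    rintro ⟨k, rfl⟩; exact hxv k rfl)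
  have hσ := inner_edge_ne_zero (openSegment_subset_segment ℝ _ _ hi) hxv
  set σ : ℝ := inner ℝ e (P (finRotate n i) - P i) with hσd
  have hσσ : 0 < σ * σ := mul_self_pos.2 hσ
  have hx0 : side P i x = 0 := side_eq_zero_of_mem_edge (openSegment_subset_segment ℝ _ _ hi)
  have hside : ∀ t, side P i (x + t • perp e) = t * σ := side_add_smul_perp P i hx0
  have hpp : (0 : ℝ) < inner ℝ (perp e) (perp e) := real_inner_self_pos.2 (perp_ne_zero he)
  have hline : ∀ t : ℝ, inner ℝ e (x + t • perp e) = c := fun t => by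
    rw [inner_add_right, inner_smul_right, inner_perp, mul_zero, add_zero, hxc]
  have htop : ∀ t : ℝ, 0 < t → x + t • perp e ∉ P.boundary ℝ := by
    intro t ht hb
    have := hmax ⟨hb, hline t⟩
    simp only [Set.mem_ofPred_eq, inner_add_right, inner_smul_right] at this
    nlinarith [mul_pos ht hpp]
  have hout : ∀ t : ℝ, 0 < t → x + t • perp e ∉ region P := by
    have hT : Convex ℝ ((fun t : ℝ => x + t • perp e) '' Set.Ioi 0) := by
      have : (fun t : ℝ => x + t • perp e) = AffineMap.lineMap x (x + perp e) := by
        ext1 t; simp [AffineMap.lineMap_apply, add_comm]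
      rw [this]
      exact (convex_Ioi 0).affine_image _
    have := subset_compl_region_of_unbounded hT
      (by rintro _ ⟨t, ht, rfl⟩; exact htop t ht)
      (not_isBounded_of_ray (x := x) (perp_ne_zero he) fun t ht => ⟨t, ht, rfl⟩)
    exact fun t ht => this ⟨t, ht, rfl⟩
  have hO : SideIn P (region P)ᶜ i σ := by
    refine hP.sideIn_of_frequently (isSaturated_compl_region P) hi fun r hr => ?_
    obtain ⟨t, ht, hb⟩ := exists_forall_add_smul_mem Metric.isOpen_ball
      (Metric.mem_ball_self hr : x ∈ Metric.ball x r) (perp e)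
    refine ⟨_, hb (t / 2) (by linarith) (by linarith), ?_, hout _ (by linarith)⟩
    rw [hside]; nlinarith [mul_pos ht hσσ]
  -- a lower boundary point on the line
  obtain ⟨s, hs, hys⟩ : ∃ s : ℝ, 0 < s ∧ x + s • -perp e ∈ region P := by
    obtain ⟨y, hy, hyc, hyx⟩ : ∃ y ∈ P.boundary ℝ, inner ℝ e y = c ∧ y ≠ x := by
      by_cases h1 : x₁ = x
      · exact ⟨x₂, openEdge_subset_boundary P _ hx₂, hx₂c, h1 ▸ hx₁₂.symm⟩
      · exact ⟨x₁, openEdge_subset_boundary P _ hx₁, hx₁c, h1⟩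
    obtain ⟨t, rfl⟩ := exists_eq_add_smul_perp he (hxc.trans hyc.symm)
    refine ⟨-t, ?_, by rw [smul_neg, neg_smul, neg_neg]; exact Or.inr hy⟩
    by_contra! h1
    rcases (neg_nonpos.1 h1).eq_or_lt with h2 | h2
    · simp [← h2] at hyx
    · exact htop t h2 hy
  have hseg : ∀ t : ℝ, 0 < t → t < s → x + t • -perp e ∈ region P := by
    intro t ht hts
    refine h.segment_subset he (Or.inr hxb) hys ?_ ?_
    · rw [smul_neg, ← neg_smul, hline, hxc]
    · rw [segment_eq_image']
      refine ⟨t / s, ⟨by positivity, (div_le_one hs).2 hts.le⟩, ?_⟩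
      simp only [add_sub_cancel_left, smul_smul]
      rw [div_mul_cancel₀ _ hs.ne']
  have hI : SideIn P (polyInterior P) i (-σ) := by
    refine hP.sideIn_of_frequently (isSaturated_polyInterior P) hi fun r hr => ?_
    obtain ⟨t, ht, hb⟩ := exists_forall_add_smul_mem
      (Metric.isOpen_ball.inter (isClosed_otherEdges P i).isOpen_compl)
      (⟨Metric.mem_ball_self hr, Set.disjoint_left.1 (hP.disjoint_openEdge_otherEdges i) hi⟩ :
        x ∈ Metric.ball x r ∩ (otherEdges P i)ᶜ) (-perp e)
    obtain ⟨τ, hτ0, hτ⟩ := exists_between (lt_min ht hs)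
    obtain ⟨hb1, hb2⟩ := hb τ hτ0 (hτ.trans_le (min_le_left _ _))
    have hsd : side P i (x + τ • -perp e) = -τ * σ := by rw [smul_neg, ← neg_smul, hside]
    have hpos : 0 < -σ * side P i (x + τ • -perp e) := by
      rw [hsd]; nlinarith [mul_pos hτ0 hσσ]
    refine ⟨_, hb1, hpos, mem_polyInterior_iff.2
      ⟨hseg τ hτ0 (hτ.trans_le (min_le_right _ _)), fun hbd => ?_⟩⟩
    rcases mem_edge_or_otherEdges hbd i with h1 | h1
    · rw [side_eq_zero_of_mem_edge h1, mul_zero] at hpos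
      exact hpos.false
    · exact hb2 h1
  exact ⟨σ, hσ, hP.sideIn_all (isSaturated_compl_region P) hσ hO,
    hP.sideIn_all (isSaturated_polyInterior P) (neg_ne_zero.2 hσ) hI⟩

/-- On a vertical line through a point of a non-vertical edge, all other points of the region are
on the inner side of this edge. -/
lemma IsOuterSign.side_pos {σ : ℝ} (hσ : IsOuterSign P σ) {e : Plane} (he : e ≠ 0)
    (h : IsMonotoneIn P e) {k : Fin n} {x z : Plane}
    (hx : x ∈ openSegment ℝ (P k) (P (finRotate n k)))
    (hk : inner ℝ e (P (finRotate n k) - P k) ≠ 0) (hz : z ∈ region P)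
    (hxz : inner ℝ e x = inner ℝ e z) (hne : z ≠ x) : 0 < -σ * side P k z := by
  have hx' := openSegment_subset_segment ℝ _ _ hx
  have hx0 := side_eq_zero_of_mem_edge hx'
  have hxb : x ∈ region P := Or.inr (mem_boundary_iff.2 ⟨k, hx'⟩)
  by_contra! hle
  have hpos : 0 < σ * side P k z := by
    refine lt_of_le_of_ne (by linarith) (Ne.symm (mul_ne_zero hσ.ne_zero ?_))
    obtain ⟨t, rfl⟩ := exists_eq_add_smul_perp he hxz
    rw [side_add_smul_perp P k hx0]
    refine mul_ne_zero ?_ hk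
    rintro rfl
    simp at hne
  obtain ⟨r, hr, hO⟩ := hσ.outside k x hx
  obtain ⟨t, ht, hb⟩ := exists_forall_add_smul_mem Metric.isOpen_ball
    (Metric.mem_ball_self hr : x ∈ Metric.ball x r) (z - x)
  obtain ⟨τ, hτ0, hτ⟩ := exists_between (lt_min ht one_pos)
  have hτ1 := hτ.trans_le (min_le_right _ _)
  have heq : x + τ • (z - x) = (1 - τ) • x + τ • z := by
    rw [sub_smul, one_smul, smul_sub]; abel
  refine hO _ (hb τ hτ0 (hτ.trans_le (min_le_left _ _))) ?_
    (h.segment_subset he hxb hz hxz (openSegment_subset_segment ℝ _ _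
      (add_smul_sub_mem_openSegment x z hτ0 hτ1)))
  rw [heq, side_comb P k x z (by ring), hx0]
  nlinarith [mul_pos hτ0 hpos]

/-- In a vertical strip without vertices in its interior, the interior of a monotone polygon is
convex, being cut out by the two edges crossing the strip. Hence an interior point on the left
border of the strip or inside of it sees all points of the region inside of the strip. -/
lemma IsOuterSign.openSegment_subset {σ : ℝ} (hσ : IsOuterSign P σ) (hP : IsSimple P) {e : Plane}
    (he : e ≠ 0) (h : IsMonotoneIn P e) {c' : ℝ} {l p : Plane} (hl : l ∈ polyInterior P)
    (hc : ∀ k, inner ℝ e (P k) ∉ Set.Ioo (inner ℝ e l) c') (hp : p ∈ region P)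
    (hlp : inner ℝ e l < inner ℝ e p) (hpc : inner ℝ e p < c') :
    openSegment ℝ l p ⊆ polyInterior P := by
  set c : ℝ := inner ℝ e l with hcd
  set m : ℝ := inner ℝ e p with hmd
  obtain ⟨i, hi⟩ := hP.exists_isLeftmost e
  obtain ⟨j, hj⟩ := hP.exists_isRightmost e
  have hcm : ∀ m', c < m' → m' < c' → ∀ k, inner ℝ e (P k) ≠ m' :=
    fun m' h1 h2 k hk => hc k ⟨hk ▸ h1, hk ▸ h2⟩
  have him : inner ℝ e (P i) < m :=
    lt_of_le_of_ne (hi.inner_le he hp) (hcm m hlp hpc i)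
  have hjm : m < inner ℝ e (P j) :=
    lt_of_le_of_ne (inner_le_of_mem_region he hj hp) (hcm m hlp hpc j).symm
  -- an edge crossing the strip rightwards and one crossing it leftwards
  obtain ⟨u, hu, hu'⟩ := exists_edge_crossing_right him hjm (hcm m hlp hpc)
  obtain ⟨d, hd, hd'⟩ := exists_edge_crossing_left him hjm (hcm m hlp hpc)
  have hleft : ∀ k, inner ℝ e (P k) < m → inner ℝ e (P k) ≤ c := fun k hk => by
    by_contra! h1; exact hc k ⟨h1, hk.trans hpc⟩
  have hright : ∀ k, m < inner ℝ e (P k) → c' ≤ inner ℝ e (P k) := fun k hk => by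
    by_contra! h1; exact hc k ⟨hlp.trans hk, h1⟩
  have hqu : ∀ m', c < m' → m' < c' →
      ∃ q ∈ openSegment ℝ (P u) (P (finRotate n u)), inner ℝ e q = m' := fun m' h1 h2 =>
    exists_mem_openSegment_inner_eq ((hleft _ hu).trans_lt h1) (h2.trans_le (hright _ hu'))
  have hqd : ∀ m', c < m' → m' < c' →
      ∃ q ∈ openSegment ℝ (P d) (P (finRotate n d)), inner ℝ e q = m' := fun m' h1 h2 => by
    rw [openSegment_symm]
    exact exists_mem_openSegment_inner_eq ((hleft _ hd).trans_lt h1) (h2.trans_le (hright _ hd'))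
  have hud : u ≠ d := by rintro rfl; linarith
  have hu0 : (inner ℝ e (P (finRotate n u) - P u) : ℝ) ≠ 0 := by
    rw [inner_sub_right]; linarith
  have hd0 : (inner ℝ e (P (finRotate n d) - P d) : ℝ) ≠ 0 := by
    rw [inner_sub_right]; linarith
  -- points of the region are on the inner side of both edges
  have hnonneg : ∀ z ∈ region P, c < inner ℝ e z → inner ℝ e z < c' →
      0 ≤ -σ * side P u z ∧ 0 ≤ -σ * side P d z := by
    intro z hz h1 h2
    obtain ⟨q, hq, hqz⟩ := hqu _ h1 h2
    obtain ⟨q', hq', hqz'⟩ := hqd _ h1 h2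
    constructor
    · by_cases hzq : z = q
      · rw [hzq, side_eq_zero_of_mem_edge (openSegment_subset_segment ℝ _ _ hq), mul_zero]
      · exact (hσ.side_pos he h hq hu0 hz hqz hzq).le
    · by_cases hzq : z = q'
      · rw [hzq, side_eq_zero_of_mem_edge (openSegment_subset_segment ℝ _ _ hq'), mul_zero]
      · exact (hσ.side_pos he h hq' hd0 hz hqz' hzq).le
  have hpos : ∀ z ∈ polyInterior P, c < inner ℝ e z → inner ℝ e z < c' →
      0 < -σ * side P u z ∧ 0 < -σ * side P d z := by
    intro z hz h1 h2
    obtain ⟨q, hq, hqz⟩ := hqu _ h1 h2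
    obtain ⟨q', hq', hqz'⟩ := hqd _ h1 h2
    refine ⟨hσ.side_pos he h hq hu0 (Or.inl hz) hqz ?_,
      hσ.side_pos he h hq' hd0 (Or.inl hz) hqz' ?_⟩
    · rintro rfl; exact hz.1 (openEdge_subset_boundary P _ hq)
    · rintro rfl; exact hz.1 (openEdge_subset_boundary P _ hq')
  -- points strictly on the inner side of both edges are in the interior
  have hconv : ∀ z, c < inner ℝ e z → inner ℝ e z < c' → 0 < -σ * side P u z →
      0 < -σ * side P d z → z ∈ polyInterior P := by
    intro z h1 h2 hzu hzd
    obtain ⟨q, hq, hqz⟩ := hqu _ h1 h2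
    obtain ⟨q', hq', hqz'⟩ := hqd _ h1 h2
    have hqr : q ∈ region P := Or.inr (openEdge_subset_boundary P _ hq)
    have hqr' : q' ∈ region P := Or.inr (openEdge_subset_boundary P _ hq')
    have hqq : q ≠ q' := by
      rintro rfl
      exact hud (hP.eq_of_mem_openEdge_of_mem_edge hq (openSegment_subset_segment ℝ _ _ hq'))
    have hqu0 := side_eq_zero_of_mem_edge (openSegment_subset_segment ℝ _ _ hq)
    have hqd0 := side_eq_zero_of_mem_edge (openSegment_subset_segment ℝ _ _ hq')
    have hq'u := hσ.side_pos he h hq hu0 hqr' (hqz.trans hqz'.symm) hqq.symm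
    have hqd' := hσ.side_pos he h hq' hd0 hqr (hqz'.trans hqz.symm) hqq
    obtain ⟨t, hzt⟩ : ∃ t : ℝ, z = (1 - t) • q + t • q' := by
      obtain ⟨a, ha⟩ := exists_eq_add_smul_perp he (hqz.trans hqz'.symm)
      obtain ⟨b, hb⟩ := exists_eq_add_smul_perp he hqz
      have ha0 : a ≠ 0 := by rintro rfl; simp at ha; exact hqq ha.symm
      refine ⟨b / a, ?_⟩
      rw [hb, ha, smul_add, ← add_assoc, ← add_smul, smul_smul, div_mul_cancel₀ _ ha0,
        sub_add_cancel, one_smul]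
    have hzu' := hzu
    have hzd' := hzd
    rw [hzt, side_comb P _ _ _ (by ring), hqu0, mul_zero, zero_add] at hzu
    rw [hzt, side_comb P _ _ _ (by ring), hqd0, mul_zero, add_zero] at hzd
    have ht0 : 0 < t := by
      by_contra! h3; nlinarith
    have ht1 : t < 1 := by
      by_contra! h3; nlinarith
    have hzr : z ∈ region P := h.segment_subset he hqr hqr' (hqz.trans hqz'.symm)
      ⟨1 - t, t, by linarith, ht0.le, by ring, hzt.symm⟩
    refine mem_polyInterior_iff.2 ⟨hzr, fun hzb => ?_⟩
    -- a boundary point between the two edges would have the region on both of its sides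
    have hzv := hcm _ h1 h2
    obtain ⟨k, hk⟩ := mem_openEdge_of_mem_boundary hzb (by rintro ⟨k, rfl⟩; exact hzv k rfl)
    have hk' := openSegment_subset_segment ℝ _ _ hk
    have hk0 := inner_edge_ne_zero hk' hzv
    have hside0 := side_eq_zero_of_mem_edge hk'
    have hzq : q ≠ z := by rintro rfl; simp [hqu0] at hzu'
    have hzq' : q' ≠ z := by rintro rfl; simp [hqd0] at hzd'
    have h3 := hσ.side_pos he h hk hk0 hqr hqz.symm hzq
    have h4 := hσ.side_pos he h hk hk0 hqr' hqz'.symm hzq'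
    rw [hzt, side_comb P _ _ _ (by ring)] at hside0
    have h5 : -σ * ((1 - t) * side P k q + t * side P k q') = 0 := by rw [hside0, mul_zero]
    nlinarith [mul_pos (sub_pos.2 ht1) h3, mul_pos ht0 h4]
  rintro z hz
  rw [openSegment_eq_image'] at hz
  obtain ⟨τ, ⟨hτ0, hτ1⟩, rfl⟩ := hz
  obtain ⟨t, ht, hb⟩ := exists_forall_add_smul_mem (isOpen_polyInterior P) hl (p - l)
  obtain ⟨s, hs0, hs⟩ := exists_between (lt_min ht hτ0)
  have hsτ := hs.trans_le (min_le_right _ _)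
  have hint := hb s hs0 (hs.trans_le (min_le_left _ _))
  have hheight : ∀ s : ℝ, 0 < s → s < 1 →
      c < inner ℝ e (l + s • (p - l)) ∧ inner ℝ e (l + s • (p - l)) < c' := by
    intro s h0 h1
    rw [inner_add_right, inner_smul_right, inner_sub_right, ← hcd, ← hmd]
    constructor <;> nlinarith
  have hs1 := hheight s hs0 (hsτ.trans hτ1)
  have hs2 := hheight τ hτ0 hτ1
  have h1 := hpos _ hint hs1.1 hs1.2
  have h2 := hnonneg p hp hlp hpc
  have hs10 : 0 < 1 - s := by linarith
  have heq : l + τ • (p - l) = ((1 - τ) / (1 - s)) • (l + s • (p - l)) +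
      ((τ - s) / (1 - s)) • p := by
    ext k
    simp only [PiLp.add_apply, PiLp.smul_apply, PiLp.sub_apply, smul_eq_mul]
    field_simp
    ring
  have hsum : (1 - τ) / (1 - s) + (τ - s) / (1 - s) = 1 := by
    field_simp; ring
  have hw1 : 0 < (1 - τ) / (1 - s) := div_pos (by linarith) hs10
  have hw2 : 0 < (τ - s) / (1 - s) := div_pos (by linarith) hs10
  change l + τ • (p - l) ∈ polyInterior P
  refine hconv _ hs2.1 hs2.2 ?_ ?_
  · rw [heq, side_comb P u _ _ hsum]
    nlinarith [mul_pos hw1 h1.1, mul_nonneg hw2.le h2.1]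
  · rw [heq, side_comb P d _ _ hsum]
    nlinarith [mul_pos hw1 h1.2, mul_nonneg hw2.le h2.2]

/-! ### Existence of geodesic paths -/

/-- `f` is a curve from `a` to `b` inside of `K`, parametrized over the unit interval with Lipschitz
constant `ℓ`. -/
structure IsLipCurve (K : Set Plane) (a b : Plane) (ℓ : ℝ) (f : unitInterval → Plane) : Prop where
  mem : ∀ t, f t ∈ K
  source : f 0 = a
  target : f 1 = b
  dist_le : ∀ s t, dist (f s) (f t) ≤ ℓ * dist s t

lemma IsLipCurve.nonneg {K : Set Plane} {a b : Plane} {ℓ : ℝ} {f : unitInterval → Plane}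
    (h : IsLipCurve K a b ℓ f) : 0 ≤ ℓ := by
  have h1 := dist_nonneg.trans (h.dist_le 0 1)
  have h2 : dist (0 : unitInterval) 1 = 1 := by simp [Subtype.dist_eq]
  rwa [h2, mul_one] at h1

/-- The pairs of a Lipschitz constant and a Lipschitz curve form a closed subset of a product of
compact sets, so there is a curve with the least Lipschitz constant. -/
lemma IsLipCurve.exists_min {K : Set Plane} (hK : IsCompact K) {a b : Plane} {ℓ₀ : ℝ}
    {f₀ : unitInterval → Plane} (h₀ : IsLipCurve K a b ℓ₀ f₀) : ∃ ℓ f, IsLipCurve K a b ℓ f ∧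
      ∀ ℓ' f', IsLipCurve K a b ℓ' f' → ℓ ≤ ℓ' := by
  have hC : IsCompact (Set.Icc (0 : ℝ) ℓ₀ ×ˢ Set.univ.pi fun _ : unitInterval => K) :=
    isCompact_Icc.prod (isCompact_univ_pi fun _ => hK)
  have hcl : IsClosed {p : ℝ × (unitInterval → Plane) | p.2 0 = a ∧ p.2 1 = b ∧
      ∀ s t, dist (p.2 s) (p.2 t) ≤ p.1 * dist s t} := by
    simp only [Set.ofPred_and, Set.ofPred_forall]
    refine IsClosed.inter ?_ (IsClosed.inter ?_ ?_)
    · exact isClosed_eq (by fun_prop) continuous_const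
    · exact isClosed_eq (by fun_prop) continuous_const
    · exact isClosed_iInter fun s => isClosed_iInter fun t =>
        isClosed_le (by fun_prop) (by fun_prop)
  obtain ⟨⟨ℓ, f⟩, ⟨⟨-, hfK⟩, hf0, hf1, hfd⟩, hmin⟩ := (hC.inter_right hcl).exists_isMinOn
    ⟨(ℓ₀, f₀), ⟨⟨h₀.nonneg, le_rfl⟩, fun t _ => h₀.mem t⟩, h₀.source, h₀.target, h₀.dist_le⟩
    (f := Prod.fst) continuous_fst.continuousOn
  refine ⟨ℓ, f, ⟨fun t => hfK t trivial, hf0, hf1, hfd⟩, fun ℓ' f' h' => ?_⟩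
  have key : ∀ ℓ' f', ℓ' ≤ ℓ₀ → IsLipCurve K a b ℓ' f' → ℓ ≤ ℓ' := fun ℓ' f' hle h' =>
    hmin (a := (ℓ', f')) ⟨⟨⟨h'.nonneg, hle⟩, fun t _ => h'.mem t⟩, h'.source, h'.target,
      h'.dist_le⟩
  rcases le_total ℓ' ℓ₀ with hle | hle
  · exact key ℓ' f' hle h'
  · exact (key ℓ₀ f₀ le_rfl h₀).trans hle

lemma eVariationOn_Icc_le {f : unitInterval → Plane} {ℓ : ℝ} (hℓ : 0 ≤ ℓ) {a b : unitInterval}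
    (h : ∀ s ∈ Set.Icc a b, ∀ t ∈ Set.Icc a b, dist (f s) (f t) ≤ ℓ * dist s t) :
    eVariationOn f (Set.Icc a b) ≤ ENNReal.ofReal (ℓ * (b - a)) := by
  refine iSup_le ?_
  rintro ⟨N, u, hu, hus⟩
  have h1 : ∀ k, edist (f (u (k + 1))) (f (u k)) ≤
      ENNReal.ofReal (ℓ * ((u (k + 1) : ℝ) - u k)) := by
    intro k
    rw [edist_dist]
    refine ENNReal.ofReal_le_ofReal ((h _ (hus _) _ (hus _)).trans_eq ?_)
    rw [Subtype.dist_eq, Real.dist_eq, abs_of_nonneg]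
    exact sub_nonneg.2 (hu (Nat.le_succ k))
  refine (Finset.sum_le_sum fun k _ => h1 k).trans ?_
  rw [← ENNReal.ofReal_sum_of_nonneg fun k _ =>
    mul_nonneg hℓ (sub_nonneg.2 (hu (Nat.le_succ k)))]
  refine ENNReal.ofReal_le_ofReal ?_
  rw [← Finset.mul_sum, Finset.sum_range_sub fun k => (u k : ℝ)]
  have h2 : (u N : ℝ) ≤ b := (hus N).2
  have h3 : (a : ℝ) ≤ u 0 := (hus 0).1
  gcongr

lemma eVariationOn_Iic_add_le (f : unitInterval → Plane) {s t : unitInterval} (hst : s ≤ t) :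
    eVariationOn f (Set.Iic s) + edist (f s) (f t) ≤ eVariationOn f (Set.Iic t) := by
  refine (add_le_add_right (eVariationOn.edist_le f (s := Set.Icc s t) ⟨le_rfl, hst⟩
    ⟨hst, le_rfl⟩) _).trans ((eVariationOn.add_le_union f fun x hx y hy => ?_).trans
    (eVariationOn.mono f ?_))
  · exact (Set.mem_Iic.1 hx).trans hy.1
  · rintro x (hx | hx)
    · exact (Set.mem_Iic.1 hx).trans hst
    · exact hx.2

/-- A path of length at most `ℓ` has a reparametrization with Lipschitz constant `ℓ`. At the time
`s` it visits the last point up to which the path has a length of at most `ℓ * s`. -/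
lemma exists_isLipCurve_of_pathLength_le {p q : Plane} (γ : Path p q) {ℓ : ℝ} (hℓ : 0 ≤ ℓ)
    (h : pathLength γ ≤ ENNReal.ofReal ℓ) : ∃ f, IsLipCurve (Set.range γ) p q ℓ f := by
  set φ : unitInterval → ENNReal := fun t => eVariationOn (fun t => γ t) (Set.Iic t) with hφ
  have hφmono : Monotone φ := fun s t hst => eVariationOn.mono _ (Set.Iic_subset_Iic.2 hst)
  set A : unitInterval → Set unitInterval := fun s => {t | φ t ≤ ENNReal.ofReal (ℓ * s)} with hA
  have hφ0 : φ 0 = 0 := eVariationOn.subsingleton _ (by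
    intro x hx y hy
    exact (le_antisymm hx (show (0 : unitInterval) ≤ x from x.2.1)).trans
      (le_antisymm hy (show (0 : unitInterval) ≤ y from y.2.1)).symm)
  have hA0 : ∀ s, (0 : unitInterval) ∈ A s := fun s => by
    change φ 0 ≤ _; rw [hφ0]; exact zero_le
  set τ : unitInterval → unitInterval := fun s => sSup (A s) with hτ
  have hlub : ∀ s, IsLUB (A s) (τ s) := fun s => isLUB_sSup _
  have hgt : ∀ s t, τ s < t → ENNReal.ofReal (ℓ * s) < φ t := fun s t hst => by
    by_contra! h1
    exact ((hlub s).1 h1).not_gt hst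
  have hlt : ∀ s t, t < τ s → φ t ≤ ENNReal.ofReal (ℓ * s) := fun s t hst => by
    obtain ⟨t', ht', htt'⟩ := (lt_isLUB_iff (hlub s)).1 hst
    exact (hφmono htt'.le).trans ht'
  have hτmono : Monotone τ := fun s s' hss => sSup_le_sSup fun t ht =>
    le_trans (b := ENNReal.ofReal (ℓ * s)) ht
      (ENNReal.ofReal_le_ofReal (mul_le_mul_of_nonneg_left hss hℓ))
  have key : ∀ s s', s ≤ s' → dist (γ (τ s)) (γ (τ s')) ≤ ℓ * s' - ℓ * s := by
    intro s s' hss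
    have hnn : ℓ * (s : ℝ) ≤ ℓ * s' := mul_le_mul_of_nonneg_left hss hℓ
    rcases (hτmono hss).eq_or_lt with heq | hlt'
    · rw [heq, dist_self]; linarith
    have h1 : ∀ t t', τ s < t → t ≤ t' → t' < τ s' → dist (γ t) (γ t') ≤ ℓ * s' - ℓ * s := by
      intro t t' ht htt ht'
      have h2 := (add_le_add_left (hgt s t ht).le _).trans
        ((eVariationOn_Iic_add_le (fun t => γ t) htt).trans (hlt s' t' ht'))
      rw [edist_dist, ← ENNReal.ofReal_add (mul_nonneg hℓ s.2.1) dist_nonneg,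
        ENNReal.ofReal_le_ofReal_iff (mul_nonneg hℓ s'.2.1)] at h2
      linarith
    have h2 : ∀ t, τ s < t → t < τ s' → dist (γ t) (γ (τ s')) ≤ ℓ * s' - ℓ * s := by
      intro t ht ht'
      have : (𝓝[<] τ s').NeBot := nhdsLT_neBot_of_exists_lt ⟨_, ht'⟩
      have hc : Tendsto (fun t' => dist (γ t) (γ t')) (𝓝[<] τ s') (𝓝 (dist (γ t) (γ (τ s')))) :=
        (Continuous.tendsto (by fun_prop) _).mono_left nhdsWithin_le_nhds
      refine le_of_tendsto hc ?_
      filter_upwards [Ioo_mem_nhdsLT ht'] with t' h3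
      exact h1 t t' ht h3.1.le h3.2
    have : (𝓝[>] τ s).NeBot := nhdsGT_neBot_of_exists_gt ⟨_, hlt'⟩
    have hc : Tendsto (fun t => dist (γ t) (γ (τ s'))) (𝓝[>] τ s)
        (𝓝 (dist (γ (τ s)) (γ (τ s')))) :=
      (Continuous.tendsto (by fun_prop) _).mono_left nhdsWithin_le_nhds
    refine le_of_tendsto hc ?_
    filter_upwards [Ioo_mem_nhdsGT hlt'] with t h3
    exact h2 t h3.1 h3.2
  refine ⟨fun s => γ (τ s), fun t => Set.mem_range_self _, ?_, ?_, ?_⟩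
  · -- the path does not move as long as its length vanishes
    have hcl : IsClosed {t | γ t = p} := isClosed_eq (by fun_prop) continuous_const
    refine hcl.closure_subset_iff.2 ?_ ((hlub 0).mem_closure ⟨0, hA0 0⟩)
    intro t ht
    have h1 := eVariationOn_Iic_add_le (fun t => γ t) (show (0 : unitInterval) ≤ t from t.2.1)
    have h2 : φ t ≤ 0 := by simpa [hA] using ht
    have h3 : edist (γ 0) (γ t) = 0 := le_antisymm ((le_add_self.trans h1).trans h2) zero_le
    rw [edist_eq_zero, γ.source] at h3
    exact h3.symm
  · have : τ 1 = 1 := le_antisymm le_top ((hlub 1).1 (by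
      change φ 1 ≤ _
      rw [Set.Icc.coe_one, mul_one]
      exact (eVariationOn.mono _ (Set.subset_univ _)).trans h))
    change γ (τ 1) = q
    rw [this, γ.target]
  · intro s s'
    rcases le_total s s' with hss | hss
    · refine (key s s' hss).trans_eq ?_
      rw [Subtype.dist_eq, Real.dist_eq, abs_sub_comm,
        abs_of_nonneg (sub_nonneg.2 (Subtype.coe_le_coe.2 hss))]; ring
    · rw [dist_comm]
      refine (key s' s hss).trans_eq ?_
      rw [Subtype.dist_eq, Real.dist_eq,
        abs_of_nonneg (sub_nonneg.2 (Subtype.coe_le_coe.2 hss))]; ring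

lemma IsLipCurve.trans {K : Set Plane} {a b c : Plane} {ℓ₁ ℓ₂ : ℝ} {f g : unitInterval → Plane}
    (hf : IsLipCurve K a b ℓ₁ f) (hg : IsLipCurve K b c ℓ₂ g) :
    ∃ h, IsLipCurve K a c (2 * (ℓ₁ + ℓ₂)) h := by
  set pr : ℝ → unitInterval := Set.projIcc 0 1 zero_le_one with hpr
  have hpr1 : ∀ x : ℝ, 1 ≤ x → pr x = 1 := fun x hx => Set.projIcc_of_right_le _ hx
  have hpr0 : ∀ x : ℝ, x ≤ 0 → pr x = 0 := fun x hx => Set.projIcc_of_le_left _ hx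
  have hprd : ∀ x y, dist (pr x) (pr y) ≤ |x - y| := fun x y => by
    rw [Subtype.dist_eq, Real.dist_eq]; exact Set.abs_projIcc_sub_projIcc _
  -- at any time, one of the two summands rests at `b`
  refine ⟨fun t => f (pr (2 * t)) + g (pr (2 * t - 1)) - b, ?_, ?_, ?_, ?_⟩
  · intro t
    rcases le_total (2 * (t : ℝ)) 1 with h | h
    · rw [hpr0 (2 * t - 1) (by linarith), hg.source, add_sub_cancel_right]
      exact hf.mem _
    · rw [hpr1 _ h, hf.target, add_sub_cancel_left]
      exact hg.mem _
  · simp [hpr0 0 le_rfl, hpr0 (-1) (by norm_num), hf.source, hg.source]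
  · have h1 : pr (2 * 1 - 1) = 1 := hpr1 _ (by norm_num)
    have h2 : pr (2 * 1) = 1 := hpr1 _ (by norm_num)
    simp only [Set.Icc.coe_one, h1, h2, hf.target, hg.target, add_sub_cancel_left]
  · intro s t
    have h1 := (hf.dist_le (pr (2 * s)) (pr (2 * t))).trans
      (mul_le_mul_of_nonneg_left (hprd _ _) hf.nonneg)
    have h2 := (hg.dist_le (pr (2 * s - 1)) (pr (2 * t - 1))).trans
      (mul_le_mul_of_nonneg_left (hprd _ _) hg.nonneg)
    have e1 : |2 * (s : ℝ) - 2 * t| = 2 * dist s t := by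
      rw [Subtype.dist_eq, Real.dist_eq, ← mul_sub, abs_mul, abs_of_pos (two_pos : (0 : ℝ) < 2)]
    have e2 : |2 * (s : ℝ) - 1 - (2 * t - 1)| = 2 * dist s t := by rw [← e1]; congr 1; ring
    rw [e1] at h1
    rw [e2] at h2
    rw [dist_sub_right]
    refine (dist_add_add_le _ _ _ _).trans ?_
    linarith

lemma isLipCurve_segment {K : Set Plane} {a b : Plane} (h : segment ℝ a b ⊆ K) :
    IsLipCurve K a b (dist a b) fun t => AffineMap.lineMap a b (t : ℝ) := by
  refine ⟨fun t => h ?_, by simp, by simp, fun s t => ?_⟩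
  · rw [segment_eq_image_lineMap]; exact ⟨t, t.2, rfl⟩
  · rw [dist_lineMap_lineMap, mul_comm, Subtype.dist_eq]

/-- The boundary joins any two vertices by a curve of finite length. -/
lemma exists_isLipCurve_boundary (P : Polygon Plane n) (i j : Fin n) :
    ∃ ℓ f, IsLipCurve (P.boundary ℝ) (P i) (P j) ℓ f := by
  refine forall_of_forall_finRotate (p := fun j => ∃ ℓ f, IsLipCurve (P.boundary ℝ) (P i) (P j) ℓ f)
    (fun k ⟨ℓ, f, hf⟩ => ?_) (i := i) ⟨_, _, isLipCurve_segment ?_⟩ j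
  · have hseg : segment ℝ (P k) (P (finRotate n k)) ⊆ P.boundary ℝ :=
      (edgeSet_eq_segment P k).ge.trans (edgeSet_subset_boundary P k)
    exact ⟨_, hf.trans (isLipCurve_segment hseg)⟩
  · rw [segment_same]
    exact Set.singleton_subset_iff.2 (vertex_mem_boundary P i)

/-- A geodesic path between two vertices exists, and it has finite length. -/
lemma exists_isGeodesic (P : Polygon Plane n) (i j : Fin n) :
    ∃ γ : Path (P i) (P j), IsGeodesic P γ ∧ pathLength γ ≠ ⊤ := by
  obtain ⟨ℓ₀, f₀, h₀⟩ := exists_isLipCurve_boundary P i j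
  have h₀' : IsLipCurve (region P) (P i) (P j) ℓ₀ f₀ :=
    ⟨fun t => Or.inr (h₀.mem t), h₀.source, h₀.target, h₀.dist_le⟩
  obtain ⟨ℓ, f, hf, hmin⟩ := h₀'.exists_min (isCompact_region P)
  have hcont : Continuous f :=
    (LipschitzWith.of_dist_le_mul (K := ⟨ℓ, hf.nonneg⟩) hf.dist_le).continuous
  let γ : Path (P i) (P j) := ⟨⟨f, hcont⟩, hf.source, hf.target⟩
  have hlen : pathLength γ ≤ ENNReal.ofReal ℓ := by
    have h1 : (Set.univ : Set unitInterval) = Set.Icc 0 1 := by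
      exact Set.Icc_bot_top.symm
    have h2 := eVariationOn_Icc_le (f := f) hf.nonneg (a := 0) (b := 1)
      fun s _ t _ => hf.dist_le s t
    rw [← h1] at h2
    change eVariationOn f Set.univ ≤ _
    simpa using h2
  refine ⟨γ, ⟨by rintro _ ⟨t, rfl⟩; exact hf.mem t, fun γ' hγ' => ?_⟩,
    ne_top_of_le_ne_top ENNReal.ofReal_ne_top hlen⟩
  by_cases htop : pathLength γ' = ⊤
  · rw [htop]; exact le_top
  obtain ⟨f', hf'⟩ := exists_isLipCurve_of_pathLength_le γ' ENNReal.toReal_nonneg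
    (ENNReal.ofReal_toReal htop).ge
  have := hmin _ f' ⟨fun t => hγ' (hf'.mem t), hf'.source, hf'.target, hf'.dist_le⟩
  exact hlen.trans ((ENNReal.ofReal_le_ofReal this).trans_eq (ENNReal.ofReal_toReal htop))

lemma IsGeodesic.pathLength_ne_top {i j : Fin n} {γ : Path (P i) (P j)} (h : IsGeodesic P γ) :
    pathLength γ ≠ ⊤ := by
  obtain ⟨γ', hγ', hfin⟩ := exists_isGeodesic P i j
  exact ne_top_of_le_ne_top hfin (h.2 γ' hγ'.1)

/-! ### Geodesic paths are locally straight -/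

lemma eVariationOn_univ_split (f : unitInterval → Plane) {s t : unitInterval} (hst : s ≤ t) :
    eVariationOn f Set.univ = eVariationOn f (Set.Iic s) + eVariationOn f (Set.Icc s t) +
      eVariationOn f (Set.Ici t) := by
  rw [← eVariationOn.union f (s := Set.Iic s) (t := Set.Icc s t) (x := s)
    ⟨Set.mem_Iic.2 le_rfl, fun _ hx => hx⟩ ⟨⟨le_rfl, hst⟩, fun _ hx => hx.1⟩,
    Set.Iic_union_Icc_eq_Iic hst,
    ← eVariationOn.union f (s := Set.Iic t) (t := Set.Ici t) (x := t)
    ⟨Set.mem_Iic.2 le_rfl, fun _ hx => hx⟩ ⟨Set.mem_Ici.2 le_rfl, fun _ hx => hx⟩,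
    Set.Iic_union_Ici]

/-- Wherever a geodesic path could take a straight shortcut, it is straight already: the part
between times `s` and `t` is not longer than the segment, so the triangle inequality for its points
is an equality. -/
lemma IsGeodesic.mem_segment {i j : Fin n} {γ : Path (P i) (P j)} (h : IsGeodesic P γ)
    {s t : unitInterval} (hst : s ≤ t) (hseg : segment ℝ (γ s) (γ t) ⊆ region P)
    {r : unitInterval} (hr : r ∈ Set.Icc s t) :
    γ r ∈ segment ℝ (γ s) (γ t) := by
  rcases hst.eq_or_lt with rfl | hlt
  · rw [le_antisymm hr.2 hr.1]; exact left_mem_segment ℝ _ _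
  have hpos : (0 : ℝ) < t - s := sub_pos.2 hlt
  -- the path following `γ` up to time `s`, then the segment, then `γ` from time `t` on
  set κ : unitInterval → unitInterval := fun r =>
    Set.projIcc 0 1 zero_le_one ((r - s : ℝ) / (t - s)) with hκ
  have hκc : Continuous κ := continuous_projIcc.comp (by fun_prop)
  set f : unitInterval → Plane := fun r =>
    γ (min r s) + ((κ r : ℝ) • (γ t - γ s)) + (γ (max r t) - γ t)
    with hf
  have hfl : ∀ r, r ≤ s → f r = γ r := fun r hr => by
    have h1 : κ r = 0 := Set.projIcc_of_le_left _
      (div_nonpos_of_nonpos_of_nonneg (sub_nonpos.2 hr) hpos.le)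
    simp only [hf, h1, min_eq_left hr, max_eq_right (hr.trans hst)]
    simp
  have hfr : ∀ r, t ≤ r → f r = γ r := fun r hr => by
    have h1 : κ r = 1 := Set.projIcc_of_right_le _
      ((one_le_div hpos).2 (sub_le_sub_right (show (t : ℝ) ≤ r from hr) _))
    simp only [hf, h1, min_eq_right (hst.trans hr), max_eq_left hr]
    simp
  have hfm : ∀ r ∈ Set.Icc s t, f r = γ s + ((r - s : ℝ) / (t - s)) • (γ t - γ s) := by
    intro r hr
    have h1 : (κ r : ℝ) = (r - s : ℝ) / (t - s) := by
      rw [hκ]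
      exact congrArg Subtype.val (Set.projIcc_of_mem zero_le_one (x := (r - s : ℝ) / (t - s))
        ⟨div_nonneg (sub_nonneg.2 hr.1) hpos.le,
          (div_le_one hpos).2 (sub_le_sub_right (show (r : ℝ) ≤ t from hr.2) _)⟩)
    simp only [hf, h1, min_eq_right hr.1, max_eq_right hr.2]
    simp
  have hfc : Continuous f := by
    simp only [hf]; fun_prop
  let γ' : Path (P i) (P j) := ⟨⟨f, hfc⟩, (hfl 0 s.2.1).trans γ.source,
    (hfr 1 t.2.2).trans γ.target⟩
  have hγ' : Set.range γ' ⊆ region P := by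
    rintro _ ⟨r, rfl⟩
    change f r ∈ region P
    rcases le_total r s with h1 | h1
    · rw [hfl r h1]; exact h.1 ⟨r, rfl⟩
    rcases le_total t r with h2 | h2
    · rw [hfr r h2]; exact h.1 ⟨r, rfl⟩
    · rw [hfm r ⟨h1, h2⟩]
      apply hseg
      rw [segment_eq_image']
      exact ⟨_, ⟨div_nonneg (sub_nonneg.2 h1) hpos.le,
        (div_le_one hpos).2 (sub_le_sub_right (show (r : ℝ) ≤ t from h2) _)⟩, rfl⟩
  have hvm : eVariationOn f (Set.Icc s t) ≤ edist (γ s) (γ t) := by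
    refine (eVariationOn_Icc_le (ℓ := dist (γ s) (γ t) / (t - s))
      (div_nonneg dist_nonneg hpos.le) fun x hx y hy => ?_).trans_eq ?_
    · rw [hfm x hx, hfm y hy, dist_add_left, dist_eq_norm, ← sub_smul, norm_smul, ← sub_div,
        sub_sub_sub_cancel_right, norm_div, Real.norm_of_nonneg hpos.le, Subtype.dist_eq,
        dist_comm (γ s), dist_eq_norm (γ t), dist_eq_norm (x : ℝ)]
      apply le_of_eq; ring
    · rw [div_mul_cancel₀ _ hpos.ne', edist_dist]
  have hle := h.2 γ' hγ'
  have hfin := h.pathLength_ne_top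
  have h1 : pathLength γ' = eVariationOn f Set.univ := rfl
  have h2 : pathLength γ = eVariationOn γ Set.univ := rfl
  rw [h1] at hle
  rw [h2] at hle hfin
  rw [eVariationOn_univ_split _ hst] at hle hfin
  rw [eVariationOn_univ_split f hst,
    eVariationOn.congr (f := f) (g := γ) (s := Set.Iic s) fun r hr => hfl r hr,
    eVariationOn.congr (f := f) (g := γ) (s := Set.Ici t) fun r hr => hfr r hr] at hle
  have hfin' := ENNReal.add_ne_top.1 hfin
  have hfin'' := ENNReal.add_ne_top.1 hfin'.1
  have hv : eVariationOn γ (Set.Icc s t) ≤ edist (γ s) (γ t) :=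
    (ENNReal.add_le_add_iff_left hfin''.1).1
      ((ENNReal.add_le_add_iff_right hfin'.2).1 hle) |>.trans hvm
  have hv' : edist (γ s) (γ r) + edist (γ r) (γ t) ≤ eVariationOn γ (Set.Icc s t) := by
    have := eVariationOn.add_le_union (γ : unitInterval → Plane)
      (s := Set.Icc s r) (t := Set.Icc r t)
      fun x hx y hy => hx.2.trans hy.1
    rw [Set.Icc_union_Icc_eq_Icc hr.1 hr.2] at this
    exact (add_le_add (eVariationOn.edist_le _ (Set.left_mem_Icc.2 hr.1) (Set.right_mem_Icc.2 hr.1))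
      (eVariationOn.edist_le _ (Set.left_mem_Icc.2 hr.2) (Set.right_mem_Icc.2 hr.2))).trans this
  have hd := hv'.trans hv
  rw [edist_dist, edist_dist, edist_dist, ← ENNReal.ofReal_add dist_nonneg dist_nonneg,
    ENNReal.ofReal_le_ofReal_iff dist_nonneg] at hd
  exact mem_segment_iff_wbtw.2 (dist_add_dist_eq_iff.1 (le_antisymm hd (dist_triangle _ _ _)))

lemma eq_of_mem_segment_of_dist_eq {a b x y : Plane} (hx : x ∈ segment ℝ a b)
    (hy : y ∈ segment ℝ a b) (h : dist a x = dist a y) : x = y := by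
  rw [segment_eq_image_lineMap] at hx hy
  obtain ⟨s, hs, rfl⟩ := hx
  obtain ⟨t, ht, rfl⟩ := hy
  rw [dist_left_lineMap, dist_left_lineMap, Real.norm_of_nonneg hs.1,
    Real.norm_of_nonneg ht.1] at h
  rcases eq_or_ne a b with rfl | hab
  · simp
  · rw [mul_right_cancel₀ (dist_ne_zero.2 hab) h]

lemma IsGeodesic.image_Icc {i j : Fin n} {γ : Path (P i) (P j)} (h : IsGeodesic P γ)
    {s t : unitInterval} (hst : s ≤ t) (hseg : segment ℝ (γ s) (γ t) ⊆ region P) :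
    γ '' Set.Icc s t = segment ℝ (γ s) (γ t) := by
  refine Set.Subset.antisymm (by rintro _ ⟨r, hr, rfl⟩; exact h.mem_segment hst hseg hr) ?_
  intro z hz
  have hcont : ContinuousOn (fun r : unitInterval => dist (γ s) (γ r)) (Set.Icc s t) := by fun_prop
  obtain ⟨r, hr, hrz⟩ := intermediate_value_Icc hst hcont (show dist (γ s) z ∈
    Set.Icc (dist (γ s) (γ s)) (dist (γ s) (γ t)) from ⟨by simp, by
      have := (mem_segment_iff_wbtw.1 hz).dist_add_dist
      linarith [dist_nonneg (x := z) (y := γ t)]⟩)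
  exact ⟨r, hr, eq_of_mem_segment_of_dist_eq (h.mem_segment hst hseg hr) hz hrz⟩

/-- If the region is convex in a disc around a point of a geodesic path, then within the disc the
path traces a diameter: the segment from its first to its last point in the disc. -/
lemma IsGeodesic.exists_line {i j : Fin n} {γ : Path (P i) (P j)} (h : IsGeodesic P γ) {x : Plane}
    (hx : x ∈ Set.range γ) {ρ : ℝ} (hρ : 0 < ρ)
    (hconv : Convex ℝ (region P ∩ Metric.closedBall x ρ))
    (hi : P i ∉ Metric.closedBall x ρ) (hj : P j ∉ Metric.closedBall x ρ) :
    ∃ d : Plane, d ≠ 0 ∧ ∀ z ∈ Metric.closedBall x ρ,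
      (z ∈ Set.range γ ↔ ∃ r : ℝ, z = x + r • d) := by
  have hT : IsCompact (γ ⁻¹' Metric.closedBall x ρ) :=
    (Metric.isClosed_closedBall.preimage γ.continuous).isCompact
  obtain ⟨r₀, hr₀⟩ := hx
  have hne : (γ ⁻¹' Metric.closedBall x ρ).Nonempty :=
    ⟨r₀, by rw [Set.mem_preimage, hr₀]; exact Metric.mem_closedBall_self hρ.le⟩
  obtain ⟨s, hs, hsmin⟩ := hT.exists_isLeast hne
  obtain ⟨t, ht, htmax⟩ := hT.exists_isGreatest hne
  have hst : s ≤ t := hsmin ht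
  -- the first and the last point are on the circle
  have hsρ : dist (γ s) x = ρ := by
    refine le_antisymm hs (le_of_not_gt fun hlt => ?_)
    have hs0 : 0 < s := by
      refine lt_of_le_of_ne s.2.1 fun h0 => hi ?_
      have : γ s = P i := (congrArg γ h0.symm).trans γ.source
      exact this ▸ hs
    have hev : ∀ᶠ r in 𝓝[<] s, dist (γ r) x < ρ :=
      ((Continuous.tendsto (by fun_prop : Continuous fun r => dist (γ r) x) s).mono_left
        nhdsWithin_le_nhds).eventually_lt_const hlt
    have : (𝓝[<] s).NeBot := nhdsLT_neBot_of_exists_lt ⟨_, hs0⟩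
    obtain ⟨r, hr, hrs⟩ := (hev.and self_mem_nhdsWithin).exists
    exact (hsmin (show r ∈ γ ⁻¹' Metric.closedBall x ρ from hr.le)).not_gt hrs
  have htρ : dist (γ t) x = ρ := by
    refine le_antisymm ht (le_of_not_gt fun hlt => ?_)
    have ht1 : t < 1 := by
      refine lt_of_le_of_ne t.2.2 fun h1 => hj ?_
      have : γ t = P j := (congrArg γ h1).trans γ.target
      exact this ▸ ht
    have hev : ∀ᶠ r in 𝓝[>] t, dist (γ r) x < ρ :=
      ((Continuous.tendsto (by fun_prop : Continuous fun r => dist (γ r) x) t).mono_left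
        nhdsWithin_le_nhds).eventually_lt_const hlt
    have : (𝓝[>] t).NeBot := nhdsGT_neBot_of_exists_gt ⟨_, ht1⟩
    obtain ⟨r, hr, hrt⟩ := (hev.and self_mem_nhdsWithin).exists
    exact (htmax (show r ∈ γ ⁻¹' Metric.closedBall x ρ from hr.le)).not_gt hrt
  have hsub : segment ℝ (γ s) (γ t) ⊆ region P ∩ Metric.closedBall x ρ :=
    hconv.segment_subset ⟨h.1 ⟨s, rfl⟩, hs⟩ ⟨h.1 ⟨t, rfl⟩, ht⟩
  have himg := h.image_Icc hst (hsub.trans Set.inter_subset_left)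
  have hrange : ∀ z ∈ Metric.closedBall x ρ,
      (z ∈ Set.range γ ↔ z ∈ segment ℝ (γ s) (γ t)) := by
    intro z hz
    rw [← himg]
    constructor
    · rintro ⟨r, rfl⟩; exact ⟨r, ⟨hsmin hz, htmax hz⟩, rfl⟩
    · rintro ⟨r, -, rfl⟩; exact ⟨r, rfl⟩
  have hxseg := (hrange x (Metric.mem_closedBall_self hρ.le)).1 ⟨r₀, hr₀⟩
  have hxw := (mem_segment_iff_wbtw.1 hxseg).dist_add_dist
  have hmid : x = midpoint ℝ (γ s) (γ t) := by
    apply eq_midpoint_of_dist_eq_half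
    · rw [← hxw, hsρ, dist_comm x, htρ]; ring
    · rw [← hxw, hsρ, dist_comm x, htρ]; ring
  set d : Plane := γ t - x with hd
  have hdρ : ‖d‖ = ρ := by rw [hd, ← dist_eq_norm, htρ]
  have hgt : γ t = x + d := by rw [hd, add_sub_cancel]
  have hgs : γ s = x - d := by
    have : x - d = x + x - γ t := by rw [hd]; abel
    rw [this]
    nth_rewrite 1 [hmid]
    nth_rewrite 1 [hmid]
    rw [midpoint_add_self, add_sub_cancel_right]
  refine ⟨d, norm_ne_zero_iff.1 (hdρ ▸ hρ.ne'), fun z hz => ?_⟩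
  rw [hrange z hz, hgs, hgt]
  constructor
  · rintro ⟨a, b, -, -, hab, rfl⟩
    refine ⟨b - a, ?_⟩
    rw [smul_sub, smul_add, sub_smul]
    have : a • x + b • x = x := by rw [← add_smul, hab, one_smul]
    nth_rewrite 3 [← this]
    abel
  · rintro ⟨r, rfl⟩
    rw [Metric.mem_closedBall, dist_eq_norm, add_sub_cancel_left, norm_smul, hdρ] at hz
    have hr : |r| ≤ 1 := by
      have : ‖r‖ * ρ ≤ 1 * ρ := by rwa [one_mul]
      exact le_of_mul_le_mul_right this hρ
    obtain ⟨hr1, hr2⟩ := abs_le.1 hr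
    refine ⟨(1 - r) / 2, (1 + r) / 2, by linarith, by linarith, by ring, ?_⟩
    ext k
    simp only [PiLp.add_apply, PiLp.smul_apply, PiLp.sub_apply, smul_eq_mul]
    ring

/-! ### Sets that are locally lines outside of finitely many points -/

/-- Close to every point outside of `V`, the set `X` coincides with a line and `V` has no points. -/
def IsLocallyLine (X V : Set Plane) : Prop :=
  ∀ x ∈ X \ V, ∃ ρ > 0, ∃ d : Plane, d ≠ 0 ∧ ∀ z ∈ Metric.closedBall x ρ,
    z ∉ V ∧ (z ∈ X ↔ ∃ r : ℝ, z = x + r • d)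

/-- The direction of the local line at `x` can be read off from points of `X` near `x`. -/
lemma IsLocallyLine.exists_ball {X V : Set Plane} (h : IsLocallyLine X V) {x d : Plane}
    (hx : x ∈ X \ V) (hd : d ≠ 0) (hs : ∀ η > 0, ∃ s : ℝ, s ≠ 0 ∧ |s| < η ∧ x + s • d ∈ X) :
    ∃ ρ > 0, ∀ z ∈ Metric.closedBall x ρ, z ∉ V ∧ (z ∈ X ↔ ∃ r : ℝ, z = x + r • d) := by
  obtain ⟨ρ, hρ, u, hu, hz⟩ := h x hx
  refine ⟨ρ, hρ, fun z hzb => ⟨(hz z hzb).1, ?_⟩⟩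
  have hd' : 0 < ‖d‖ := norm_pos_iff.2 hd
  obtain ⟨s, hs0, hsη, hsX⟩ := hs (ρ / ‖d‖) (div_pos hρ hd')
  have hsb : x + s • d ∈ Metric.closedBall x ρ := by
    rw [Metric.mem_closedBall, dist_eq_norm, add_sub_cancel_left, norm_smul]
    exact ((lt_div_iff₀ hd').1 hsη).le
  obtain ⟨r, hr⟩ := (hz _ hsb).2.1 hsX
  have hr' : s • d = r • u := add_left_cancel hr
  have hr0 : r ≠ 0 := by
    rintro rfl
    rw [zero_smul] at hr'
    exact (smul_ne_zero hs0 hd) hr'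
  have hdu : d = (s⁻¹ * r) • u := by rw [mul_smul, ← hr', inv_smul_smul₀ hs0]
  have hud : u = (r⁻¹ * s) • d := by rw [mul_smul, hr', inv_smul_smul₀ hr0]
  rw [(hz z hzb).2]
  constructor
  · rintro ⟨t, rfl⟩; exact ⟨t * (r⁻¹ * s), by rw [mul_smul, ← hud]⟩
  · rintro ⟨t, rfl⟩; exact ⟨t * (s⁻¹ * r), by rw [mul_smul, ← hdu]⟩

/-- Following the local line in one direction, one stays in `X \ V` until reaching a point
of `V`. -/
lemma IsLocallyLine.exists_ray {X V : Set Plane} (h : IsLocallyLine X V) (hX : IsCompact X)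
    {x d : Plane} (hx : x ∈ X \ V) (hd : d ≠ 0)
    (hs : ∀ η > 0, ∃ s : ℝ, s ≠ 0 ∧ |s| < η ∧ x + s • d ∈ X) :
    ∃ t : ℝ, 0 < t ∧ (∀ s : ℝ, 0 ≤ s → s < t → x + s • d ∈ X \ V) ∧ x + t • d ∈ X ∩ V := by
  have hd' : 0 < ‖d‖ := norm_pos_iff.2 hd
  have hforward : ∀ y : Plane, y ∈ X \ V →
      (∀ η > 0, ∃ s : ℝ, s ≠ 0 ∧ |s| < η ∧ y + s • d ∈ X) →
      ∃ ε : ℝ, 0 < ε ∧ ∀ s : ℝ, |s| ≤ ε → y + s • d ∈ X \ V := by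
    intro y hy hys
    obtain ⟨ρ, hρ, hb⟩ := h.exists_ball hy hd hys
    refine ⟨ρ / ‖d‖, div_pos hρ hd', fun s hs => ?_⟩
    have hsb : y + s • d ∈ Metric.closedBall y ρ := by
      rw [Metric.mem_closedBall, dist_eq_norm, add_sub_cancel_left, norm_smul]
      exact (le_div_iff₀ hd').1 hs
    exact ⟨(hb _ hsb).2.2 ⟨s, rfl⟩, (hb _ hsb).1⟩
  set B : Set ℝ := {t | 0 ≤ t ∧ x + t • d ∉ X \ V} with hB
  have hBne : B.Nonempty := by
    by_contra! hemp
    refine not_isBounded_of_ray (x := x) (T := X) hd (fun t ht => ?_) hX.isBounded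
    by_contra hnot
    have : t ∈ B := ⟨ht.le, fun h => hnot h.1⟩
    rw [hemp] at this
    exact this
  have hBbdd : BddBelow B := ⟨0, fun t ht => ht.1⟩
  have hbefore : ∀ s, 0 ≤ s → s < sInf B → x + s • d ∈ X \ V := by
    intro s hs0 hs
    by_contra hnot
    exact (csInf_le hBbdd ⟨hs0, hnot⟩).not_gt hs
  obtain ⟨ε, hε, hεx⟩ := hforward x hx hs
  have hpos : 0 < sInf B := by
    refine hε.trans_le (le_csInf hBne fun t ht => ?_)
    by_contra! hlt
    exact ht.2 (hεx t (by rw [abs_of_nonneg ht.1]; exact hlt.le))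
  have hmemX : x + sInf B • d ∈ X := by
    have hc : Tendsto (fun s : ℝ => x + s • d) (𝓝[<] sInf B) (𝓝 (x + sInf B • d)) :=
      (Continuous.tendsto (by fun_prop) _).mono_left nhdsWithin_le_nhds
    refine hX.isClosed.mem_of_tendsto hc ?_
    filter_upwards [Ioo_mem_nhdsLT hpos] with s hs
    exact (hbefore s hs.1.le hs.2).1
  refine ⟨sInf B, hpos, hbefore, hmemX, ?_⟩
  by_contra hnV
  obtain ⟨ε', hε', hb⟩ := hforward _ ⟨hmemX, hnV⟩ (by
    intro η hη
    obtain ⟨s, hs0, hs⟩ := exists_between (lt_min hη hpos)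
    refine ⟨-s, neg_ne_zero.2 hs0.ne', ?_, ?_⟩
    · rw [abs_neg, abs_of_pos hs0]; exact hs.trans_le (min_le_left _ _)
    · rw [add_assoc, ← add_smul]
      exact (hbefore _ (by linarith [min_le_right η (sInf B)]) (by linarith)).1)
  obtain ⟨t, htB, ht⟩ := exists_lt_of_csInf_lt hBne (lt_add_of_pos_right (sInf B) hε')
  have h1 := csInf_le hBbdd htB
  refine htB.2 ?_
  have h2 := hb (t - sInf B) (by rw [abs_of_nonneg (by linarith)]; linarith)
  rwa [add_assoc, ← add_smul, add_sub_cancel] at h2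

lemma mem_openSegment_add_smul {x d : Plane} {t₁ t₂ : ℝ} (ht : t₁ < t₂) (z : Plane) :
    z ∈ openSegment ℝ (x + t₁ • d) (x + t₂ • d) ↔ ∃ s, t₁ < s ∧ s < t₂ ∧ z = x + s • d := by
  have hmap : ∀ s : ℝ, x + s • d = AffineMap.lineMap x (x + d) s := fun s => by
    simp [AffineMap.lineMap_apply, add_comm]
  rw [hmap, hmap, ← image_openSegment ℝ (AffineMap.lineMap x (x + d)), openSegment_eq_Ioo ht]
  constructor
  · rintro ⟨s, hs, rfl⟩; exact ⟨s, hs.1, hs.2, (hmap s).symm⟩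
  · rintro ⟨s, h1, h2, rfl⟩; exact ⟨s, ⟨h1, h2⟩, (hmap s).symm⟩

/-- The components of `X \ V` are open segments between points of `V`. -/
lemma IsLocallyLine.connectedComponentIn_eq {X V : Set Plane} (h : IsLocallyLine X V)
    (hX : IsCompact X) {x : Plane} (hx : x ∈ X \ V) : ∃ a ∈ V, ∃ b ∈ V, a ≠ b ∧
      openSegment ℝ a b ⊆ X \ V ∧ connectedComponentIn (X \ V) x = openSegment ℝ a b := by
  obtain ⟨ρ, hρ, d, hd, hz⟩ := h x hx
  have hd' : 0 < ‖d‖ := norm_pos_iff.2 hd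
  have hlocal : ∀ s : ℝ, |s| < ρ / ‖d‖ → x + s • d ∈ X := by
    intro s hs
    refine (hz _ ?_).2.2 ⟨s, rfl⟩
    rw [Metric.mem_closedBall, dist_eq_norm, add_sub_cancel_left, norm_smul]
    exact ((lt_div_iff₀ hd').1 hs).le
  have hnear : ∀ η > 0, ∃ s : ℝ, s ≠ 0 ∧ |s| < η ∧ |s| < ρ / ‖d‖ := by
    intro η hη
    obtain ⟨s, hs0, hs⟩ := exists_between (lt_min hη (div_pos hρ hd'))
    exact ⟨s, hs0.ne', by rw [abs_of_pos hs0]; exact hs.trans_le (min_le_left _ _),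
      by rw [abs_of_pos hs0]; exact hs.trans_le (min_le_right _ _)⟩
  obtain ⟨t₂, ht₂, hray₂, hb⟩ := h.exists_ray hX hx hd fun η hη => by
    obtain ⟨s, hs0, hs1, hs2⟩ := hnear η hη
    exact ⟨s, hs0, hs1, hlocal s hs2⟩
  obtain ⟨t₁, ht₁, hray₁, ha⟩ := h.exists_ray hX hx (neg_ne_zero.2 hd) fun η hη => by
    obtain ⟨s, hs0, hs1, hs2⟩ := hnear η hη
    exact ⟨s, hs0, hs1, by
      rw [smul_neg, ← neg_smul]; exact hlocal _ (by rwa [abs_neg])⟩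
  rw [smul_neg, ← neg_smul] at ha
  have ht : -t₁ < t₂ := by linarith
  have hmem := mem_openSegment_add_smul (x := x) (d := d) ht
  set a := x + (-t₁) • d with had
  set b := x + t₂ • d with hbd
  have hab : a ≠ b := by
    intro hab
    have : (t₂ - -t₁) • d = 0 := by
      rw [sub_smul, sub_eq_zero]; exact (add_left_cancel hab).symm
    rcases smul_eq_zero.1 this with h1 | h1
    · linarith
    · exact hd h1
  have hsub : openSegment ℝ a b ⊆ X \ V := by
    intro z hz
    obtain ⟨s, hs1, hs2, rfl⟩ := (hmem z).1 hz
    rcases le_total 0 s with h0 | h0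
    · exact hray₂ s h0 hs2
    · have := hray₁ (-s) (by linarith) (by linarith)
      rwa [smul_neg, ← neg_smul, neg_neg] at this
  have hxO : x ∈ openSegment ℝ a b := (hmem x).2 ⟨0, by linarith, ht₂, by simp⟩
  refine ⟨a, ha.2, b, hb.2, hab, hsub, Set.Subset.antisymm ?_
    ((convex_openSegment a b).isPreconnected.subset_connectedComponentIn hxO hsub)⟩
  -- the open segment is both open and closed in `X \ V`
  have hopen : ∀ y ∈ openSegment ℝ a b, ∃ r > 0, Metric.ball y r ∩ X ⊆ openSegment ℝ a b := by
    intro y hy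
    obtain ⟨s, hs1, hs2, rfl⟩ := (hmem y).1 hy
    have hδ : 0 < min (s - -t₁) (t₂ - s) := lt_min (by linarith) (by linarith)
    have hin : ∀ r : ℝ, |r| < min (s - -t₁) (t₂ - s) → x + s • d + r • d ∈ openSegment ℝ a b := by
      intro r hr
      have h1 := abs_lt.1 (hr.trans_le (min_le_left _ _))
      have h2 := abs_lt.1 (hr.trans_le (min_le_right _ _))
      exact (hmem _).2 ⟨s + r, by linarith, by linarith, by rw [add_smul, add_assoc]⟩
    obtain ⟨ρ', hρ', hb'⟩ := h.exists_ball (hsub hy) hd fun η hη => by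
      obtain ⟨r, hr0, hr⟩ := exists_between (lt_min hη hδ)
      refine ⟨r, hr0.ne', by rw [abs_of_pos hr0]; exact hr.trans_le (min_le_left _ _),
        (hsub (hin r ?_)).1⟩
      rw [abs_of_pos hr0]; exact hr.trans_le (min_le_right _ _)
    refine ⟨min ρ' (min (s - -t₁) (t₂ - s) * ‖d‖), lt_min hρ' (mul_pos hδ hd'), ?_⟩
    rintro z ⟨hz1, hz2⟩
    have hzb : z ∈ Metric.closedBall (x + s • d) ρ' :=
      (Metric.mem_ball.1 hz1).le.trans (min_le_left _ _)
    obtain ⟨r, rfl⟩ := (hb' z hzb).2.1 hz2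
    refine hin r ?_
    have h1 := (Metric.mem_ball.1 hz1).trans_le (min_le_right _ _)
    rw [dist_eq_norm, add_sub_cancel_left, norm_smul] at h1
    exact lt_of_mul_lt_mul_right h1 hd'.le
  choose! r hr hrO using hopen
  set U : Set Plane := ⋃ y ∈ openSegment ℝ a b, Metric.ball y (r y) with hU
  have hUo : IsOpen U := isOpen_biUnion fun y _ => Metric.isOpen_ball
  have hUX : U ∩ X ⊆ openSegment ℝ a b := by
    rintro z ⟨hzU, hzX⟩
    obtain ⟨y, hy, hzy⟩ := Set.mem_iUnion₂.1 hzU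
    exact hrO y hy ⟨hzy, hzX⟩
  have hOU : openSegment ℝ a b ⊆ U := fun y hy =>
    Set.mem_iUnion₂.2 ⟨y, hy, Metric.mem_ball_self (hr y hy)⟩
  have hC := connectedComponentIn_subset (X \ V) x
  intro z hz
  by_contra hzO
  have hclosed : ∀ w ∈ X \ V, w ∈ segment ℝ a b → w ∈ openSegment ℝ a b := by
    rintro w hw hws
    refine mem_openSegment_of_mem_segment hws ?_ ?_
    · rintro rfl; exact hw.2 ha.2
    · rintro rfl; exact hw.2 hb.2
  obtain ⟨w, hwC, hwU, hwW⟩ := isPreconnected_connectedComponentIn (F := X \ V) (x := x) U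
    (segment ℝ a b)ᶜ hUo (isCompact_segment a b).isClosed.isOpen_compl
    (fun w hw => by
      by_cases hws : w ∈ segment ℝ a b
      · exact Or.inl (hOU (hclosed w (hC hw) hws))
      · exact Or.inr hws)
    ⟨x, mem_connectedComponentIn hx, hOU hxO⟩
    ⟨z, hz, fun hzs => hzO (hclosed z (hC hz) hzs)⟩
  exact hwW (openSegment_subset_segment ℝ _ _ (hUX ⟨hwU, (hC hwC).1⟩))

/-! ### Geodesic paths in monotone polygons -/

/-- The region is convex near every point that is not a vertex: it is a disc or a half-disc. -/
lemma IsOuterSign.exists_convex_inter_closedBall {σ : ℝ} (hσ : IsOuterSign P σ)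
    {x : Plane} (hP : IsSimple P) (hx : x ∈ region P) (hxV : x ∉ Set.range P.vertices) :
    ∃ ρ > 0, Convex ℝ (region P ∩ Metric.closedBall x ρ) ∧
      ∀ z ∈ Metric.closedBall x ρ, z ∉ Set.range P.vertices := by
  have hV : IsClosed (Set.range P.vertices) := (Set.finite_range _).isClosed
  obtain ⟨r, hr, hrV⟩ := Metric.isOpen_iff.1 hV.isOpen_compl x hxV
  by_cases hxb : x ∈ P.boundary ℝ
  · obtain ⟨i, hi⟩ := mem_openEdge_of_mem_boundary hxb hxV
    obtain ⟨r₁, hr₁, hO⟩ := hσ.outside i x hi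
    obtain ⟨r₂, hr₂, hI⟩ := hσ.inside i x hi
    obtain ⟨ρ, hρ, hρr⟩ := exists_between (lt_min hr (lt_min hr₁ hr₂))
    have h0 : Metric.closedBall x ρ ⊆ Metric.ball x r :=
      Metric.closedBall_subset_ball (hρr.trans_le (min_le_left _ _))
    have h1 : Metric.closedBall x ρ ⊆ Metric.ball x r₁ := Metric.closedBall_subset_ball
      (hρr.trans_le ((min_le_right _ _).trans (min_le_left _ _)))
    have h2 : Metric.closedBall x ρ ⊆ Metric.ball x r₂ := Metric.closedBall_subset_ball
      (hρr.trans_le ((min_le_right _ _).trans (min_le_right _ _)))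
    refine ⟨ρ, hρ, ?_, fun z hz => hrV (h0 hz)⟩
    have heq : region P ∩ Metric.closedBall x ρ =
        {z | 0 ≤ -σ * side P i z} ∩ Metric.closedBall x ρ := by
      ext z
      refine and_congr_left fun hz => ⟨fun hzr => ?_, fun hzs => ?_⟩
      · by_contra hneg
        rw [Set.mem_ofPred_eq, not_le] at hneg
        exact hO z (h1 hz) (by linarith) hzr
      · rcases (show 0 ≤ -σ * side P i z from hzs).lt_or_eq with h3 | h3
        · exact Or.inl (hI z (h2 hz) h3)
        · -- points on the line of the edge are limits of interior points
          have h4 : side P i z = 0 :=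
            (mul_eq_zero.1 h3.symm).resolve_left (neg_ne_zero.2 hσ.ne_zero)
          by_contra hzr
          obtain ⟨w, ⟨hw1, hw2⟩, hws⟩ := hP.exists_mem_side_pos
            (Metric.isOpen_ball.inter (isClosed_region P).isOpen_compl)
            (show z ∈ Metric.ball x r₂ ∩ (region P)ᶜ from ⟨h2 hz, hzr⟩) h4
            (neg_ne_zero.2 hσ.ne_zero)
          exact hw2 (Or.inl (hI w hw1 hws))
    rw [heq]
    refine Convex.inter (fun y hy z hz a b ha hb hab => ?_) (convex_closedBall x ρ)
    rw [Set.mem_ofPred_eq] at hy hz ⊢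
    rw [side_comb P i y z hab]
    nlinarith [mul_nonneg ha hy, mul_nonneg hb hz]
  · have hxi : x ∈ polyInterior P := mem_polyInterior_iff.2 ⟨hx, hxb⟩
    obtain ⟨r', hr', hrI⟩ := Metric.isOpen_iff.1 (isOpen_polyInterior P) x hxi
    obtain ⟨ρ, hρ, hρr⟩ := exists_between (lt_min hr hr')
    have h0 : Metric.closedBall x ρ ⊆ Metric.ball x r :=
      Metric.closedBall_subset_ball (hρr.trans_le (min_le_left _ _))
    have h1 : Metric.closedBall x ρ ⊆ region P := (Metric.closedBall_subset_ball
      (hρr.trans_le (min_le_right _ _))).trans (hrI.trans (polyInterior_subset_region P))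
    refine ⟨ρ, hρ, ?_, fun z hz => hrV (h0 hz)⟩
    rw [Set.inter_eq_right.2 h1]
    exact convex_closedBall x ρ

lemma IsGeodesic.isLocallyLine {σ : ℝ} (hσ : IsOuterSign P σ) (hP : IsSimple P) {i j : Fin n}
    {γ : Path (P i) (P j)} (h : IsGeodesic P γ) :
    IsLocallyLine (Set.range γ) (Set.range P.vertices) := by
  rintro x ⟨hx, hxV⟩
  obtain ⟨ρ, hρ, hconv, hV⟩ := hσ.exists_convex_inter_closedBall hP (h.1 hx) hxV
  obtain ⟨d, hd, hz⟩ := h.exists_line hx hρ hconv (fun h1 => hV _ h1 ⟨i, rfl⟩)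
    (fun h1 => hV _ h1 ⟨j, rfl⟩)
  exact ⟨ρ, hρ, d, hd, fun z hzb => ⟨hV z hzb, hz z hzb⟩⟩

/-- An open segment between vertices that stays in the region and avoids the vertices is a mobile
guard: it cannot cross an edge, as one side of the edge is outside, and if it touches an
edge then it runs along it and hence equals it. -/
lemma IsOuterSign.isOpenMobileGuard {σ : ℝ} (hσ : IsOuterSign P σ) (hP : IsSimple P) {i j : Fin n}
    (hij : P i ≠ P j)
    (h : openSegment ℝ (P i) (P j) ⊆ region P \ Set.range P.vertices) :
    IsOpenMobileGuard P (openSegment ℝ (P i) (P j)) := by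
  by_cases hb : ∃ y ∈ openSegment ℝ (P i) (P j), y ∈ P.boundary ℝ
  · left
    obtain ⟨y, hy, hyb⟩ := hb
    obtain ⟨k, hk⟩ := mem_openEdge_of_mem_boundary hyb (h hy).2
    have hk0 := side_eq_zero_of_mem_edge (openSegment_subset_segment ℝ _ _ hk)
    refine ⟨k, ?_⟩
    set d := P (finRotate n k) - P k with hd
    have hd0 : d ≠ 0 := sub_ne_zero.2 (hP.nondegenerate k).symm
    have hy' := hy
    rw [openSegment_eq_image'] at hy'
    obtain ⟨θ, ⟨hθ0, hθ1⟩, hθy⟩ := hy'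
    have hθy : P i + θ • (P j - P i) = y := hθy
    set v := P j - P i with hv
    have hPi : P i = y + (-θ) • v := by rw [← hθy, neg_smul, add_neg_cancel_right]
    have hPj : P j = y + (1 - θ) • v := by
      rw [← hθy, add_assoc, ← add_smul, add_sub_cancel, one_smul, hv, add_sub_cancel]
    have hmem : ∀ z, z ∈ openSegment ℝ (P i) (P j) ↔
        ∃ s, -θ < s ∧ s < 1 - θ ∧ z = y + s • v := fun z => by
      rw [hPi, hPj]; exact mem_openSegment_add_smul (by linarith) z
    have hcross : cross d v = 0 := by
      by_contra hne
      obtain ⟨r, hr, hO⟩ := hσ.outside k y hk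
      -- one of the two directions of the segment leads outside
      have key : ∀ w : Plane, 0 < σ * cross d w →
          ¬ ∃ t₀ > 0, ∀ t : ℝ, 0 < t → t < t₀ → y + t • w ∈ openSegment ℝ (P i) (P j) := by
        rintro w hw ⟨t₀, ht₀, hseg⟩
        obtain ⟨t, ht, hball⟩ := exists_forall_add_smul_mem Metric.isOpen_ball
          (Metric.mem_ball_self hr : y ∈ Metric.ball y r) w
        obtain ⟨τ, hτ0, hτ⟩ := exists_between (lt_min ht ht₀)
        refine hO _ (hball τ hτ0 (hτ.trans_le (min_le_left _ _))) ?_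
          (h (hseg τ hτ0 (hτ.trans_le (min_le_right _ _)))).1
        rw [side_add, hk0, cross_smul_right, zero_add]
        nlinarith [mul_pos hτ0 hw]
      rcases (mul_ne_zero hσ.ne_zero hne).lt_or_gt with h1 | h1
      · refine key ((-1 : ℝ) • v) (by rw [cross_smul_right]; linarith) ⟨θ, hθ0, fun t h2 h3 => ?_⟩
        exact (hmem _).2 ⟨-t, by linarith, by linarith, by rw [smul_smul]; simp⟩
      · refine key v h1 ⟨1 - θ, by linarith, fun t h2 h3 => ?_⟩
        exact (hmem _).2 ⟨t, by linarith, h3, rfl⟩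
    obtain ⟨μ, hμ⟩ := exists_smul_of_cross_eq_zero hd0 hcross
    have hμ0 : μ ≠ 0 := by
      rintro rfl
      rw [zero_smul, hv, sub_eq_zero] at hμ
      exact hij hμ.symm
    rw [openSegment_eq_image'] at hk
    obtain ⟨α, ⟨hα0, hα1⟩, hαy⟩ := hk
    have hαy : P k + α • d = y := hαy
    -- positions of all points on the line of the edge
    have hPi' : P i = P k + (α - θ * μ) • d := by
      rw [hPi, ← hαy, hμ, smul_smul, add_assoc, ← add_smul]; congr 2; ring
    have hPj' : P j = P k + (α + (1 - θ) * μ) • d := by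
      rw [hPj, ← hαy, hμ, smul_smul, add_assoc, ← add_smul]
    have hPk : P k = P k + (0 : ℝ) • d := by simp
    have hPk' : P (finRotate n k) = P k + (1 : ℝ) • d := by simp [hd]
    have hedge : ∀ z, z ∈ openSegment ℝ (P k) (P (finRotate n k)) ↔
        ∃ s : ℝ, 0 < s ∧ s < 1 ∧ z = P k + s • d := fun z => by
      have := mem_openSegment_add_smul (x := P k) (d := d) one_pos z
      rwa [← hPk, ← hPk'] at this
    have hi' : ¬ (0 < α - θ * μ ∧ α - θ * μ < 1) := fun h1 =>
      hP.vertex_notMem_openEdge i k ((hedge _).2 ⟨_, h1.1, h1.2, hPi'⟩)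
    have hj' : ¬ (0 < α + (1 - θ) * μ ∧ α + (1 - θ) * μ < 1) := fun h1 =>
      hP.vertex_notMem_openEdge j k ((hedge _).2 ⟨_, h1.1, h1.2, hPj'⟩)
    rcases hμ0.lt_or_gt with hneg | hpos
    · have h1 : θ * μ < 0 := mul_neg_of_pos_of_neg hθ0 hneg
      have h2 : (1 - θ) * μ < 0 := mul_neg_of_pos_of_neg (by linarith) hneg
      have hseg : ∀ z, z ∈ openSegment ℝ (P i) (P j) ↔
          ∃ s, α + (1 - θ) * μ < s ∧ s < α - θ * μ ∧ z = P k + s • d := fun z => by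
        rw [openSegment_symm, hPi', hPj']; exact mem_openSegment_add_smul (by linarith) z
      have h3 : 1 ≤ α - θ * μ := by by_contra! h4; exact hi' ⟨by linarith, h4⟩
      have h4 : α + (1 - θ) * μ ≤ 0 := by by_contra! h4; exact hj' ⟨h4, by linarith⟩
      have h5 : α + (1 - θ) * μ = 0 := by
        by_contra h6
        exact (h ((hseg _).2 ⟨0, lt_of_le_of_ne h4 h6, by linarith, hPk⟩)).2 ⟨k, rfl⟩
      have h6 : α - θ * μ = 1 := by
        by_contra h7
        exact (h ((hseg _).2 ⟨1, by linarith, lt_of_le_of_ne h3 (Ne.symm h7), hPk'⟩)).2 ⟨_, rfl⟩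
      rw [openSegment_symm, hPi', hPj', h5, h6, ← hPk, ← hPk']
    · have h1 : 0 < θ * μ := mul_pos hθ0 hpos
      have h2 : 0 < (1 - θ) * μ := mul_pos (by linarith) hpos
      have hseg : ∀ z, z ∈ openSegment ℝ (P i) (P j) ↔
          ∃ s, α - θ * μ < s ∧ s < α + (1 - θ) * μ ∧ z = P k + s • d := fun z => by
        rw [hPi', hPj']; exact mem_openSegment_add_smul (by linarith) z
      have h3 : 1 ≤ α + (1 - θ) * μ := by by_contra! h4; exact hj' ⟨by linarith, h4⟩
      have h4 : α - θ * μ ≤ 0 := by by_contra! h4; exact hi' ⟨h4, by linarith⟩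
      have h5 : α - θ * μ = 0 := by
        by_contra h6
        exact (h ((hseg _).2 ⟨0, lt_of_le_of_ne h4 h6, by linarith, hPk⟩)).2 ⟨k, rfl⟩
      have h6 : α + (1 - θ) * μ = 1 := by
        by_contra h7
        exact (h ((hseg _).2 ⟨1, by linarith, lt_of_le_of_ne h3 (Ne.symm h7), hPk'⟩)).2 ⟨_, rfl⟩
      rw [hPi', hPj', h5, h6, ← hPk, ← hPk']
  · right
    push Not at hb
    have hint : openSegment ℝ (P i) (P j) ⊆ polyInterior P := fun z hz =>
      mem_polyInterior_iff.2 ⟨(h hz).1, hb z hz⟩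
    have hmid : midpoint ℝ (P i) (P j) ∈ openSegment ℝ (P i) (P j) := by
      rw [openSegment_eq_image_lineMap]
      exact ⟨1 / 2, by norm_num, by rw [lineMap_one_half]⟩
    refine ⟨i, j, ⟨fun h1 => hij (congrArg P.vertices h1), ?_, ?_, ?_⟩, rfl⟩
    · rintro rfl; exact hb _ hmid (openEdge_subset_boundary P i hmid)
    · rintro rfl
      rw [openSegment_symm] at hmid
      exact hb _ (by rwa [openSegment_symm]) (openEdge_subset_boundary P j hmid)
    · rintro z ⟨hz, hzn⟩
      simp only [Set.mem_insert_iff, Set.mem_singleton_iff, not_or] at hzn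
      exact hint (mem_openSegment_of_mem_segment hz hzn.1 hzn.2)

lemma Visible.symm {p q : Plane} (h : Visible P p q) : Visible P q p := by
  rw [Visible, segment_symm, Set.pair_comm]; exact h

/-- Points of a geodesic path that see each other lie on the same open edge: between them the path
follows the line of sight, which contains no vertices. -/
lemma IsGeodesic.mem_connectedComponentIn_of_visible {i j : Fin n} {γ : Path (P i) (P j)}
    (h : IsGeodesic P γ) {s t : unitInterval} (hst : s ≤ t) (hs : γ s ∉ Set.range P.vertices)
    (ht : γ t ∉ Set.range P.vertices) (hvis : Visible P (γ s) (γ t)) :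
    γ t ∈ connectedComponentIn (Set.range γ \ Set.range P.vertices) (γ s) := by
  have hseg : segment ℝ (γ s) (γ t) ⊆ region P := by
    intro z hz
    by_cases h1 : z = γ s
    · exact h1 ▸ h.1 ⟨s, rfl⟩
    by_cases h2 : z = γ t
    · exact h2 ▸ h.1 ⟨t, rfl⟩
    exact Or.inl (hvis ⟨hz, by simp [h1, h2]⟩)
  have hsub : γ '' Set.Icc s t ⊆ Set.range γ \ Set.range P.vertices := by
    rintro _ ⟨r, hr, rfl⟩
    refine ⟨⟨r, rfl⟩, ?_⟩
    rintro ⟨k, hk⟩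
    have hne : γ r ∉ ({γ s, γ t} : Set Plane) := by
      simp only [Set.mem_insert_iff, Set.mem_singleton_iff, not_or]
      exact ⟨fun h1 => hs ⟨k, hk.trans h1⟩, fun h1 => ht ⟨k, hk.trans h1⟩⟩
    exact (hvis ⟨h.mem_segment hst hseg hr, hne⟩).1 (hk ▸ vertex_mem_boundary P k)
  exact (isPreconnected_Icc.image γ γ.continuous.continuousOn).subset_connectedComponentIn
    ⟨s, ⟨le_rfl, hst⟩, rfl⟩ hsub ⟨t, ⟨hst, le_rfl⟩, rfl⟩

lemma exists_path_inner_eq {e : Plane} {p q : Plane} (γ : Path p q) {c : ℝ}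
    (h1 : inner ℝ e p ≤ c) (h2 : c ≤ inner ℝ e q) : ∃ t, inner ℝ e (γ t) = c := by
  have hcont : Continuous fun t => (inner ℝ e (γ t) : ℝ) := by fun_prop
  obtain ⟨t, -, ht⟩ := isPreconnected_univ.intermediate_value (Set.mem_univ (0 : unitInterval))
    (Set.mem_univ (1 : unitInterval)) hcont.continuousOn
    (show c ∈ Set.Icc (inner ℝ e (γ 0) : ℝ) (inner ℝ e (γ 1)) by
      rw [γ.source, γ.target]; exact ⟨h1, h2⟩)
  exact ⟨t, ht⟩

/-- The path crosses the vertex-free strip to the right of an interior point, and the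
interior point sees the crossing point. -/
lemma IsGeodesic.exists_sees {σ : ℝ} (hσ : IsOuterSign P σ) (hP : IsSimple P) {e : Plane}
    (he : e ≠ 0) (hmono : IsMonotoneIn P e) {i j : Fin n} (hi : IsLeftmost P e i)
    (hj : IsRightmost P e j) {γ : Path (P i) (P j)} (h : IsGeodesic P γ) {l : Plane}
    (hl : l ∈ polyInterior P) : ∃ g ∈ openEdges P γ, Sees P g l := by
  have hlj : inner ℝ e l < inner ℝ e (P j) := by
    obtain ⟨t, ht, hb⟩ := exists_forall_add_smul_mem (isOpen_polyInterior P) hl e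
    have h1 := inner_le_of_mem_region he hj (Or.inl (hb (t / 2) (by linarith) (by linarith)))
    rw [inner_add_right, inner_smul_right] at h1
    nlinarith [mul_pos ht (real_inner_self_pos.2 he)]
  -- the next vertex to the right
  have : Nonempty {k : Fin n // inner ℝ e l < inner ℝ e (P k)} := ⟨⟨j, hlj⟩⟩
  obtain ⟨⟨k, hk⟩, hmin⟩ := Finite.exists_min
    fun k : {k : Fin n // inner ℝ e l < inner ℝ e (P k)} => (inner ℝ e (P k) : ℝ)
  obtain ⟨m, hlm, hmk⟩ := exists_between hk
  have hc : ∀ k', inner ℝ e (P k') ∉ Set.Ioo (inner ℝ e l) (inner ℝ e (P k)) :=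
    fun k' h1 => (hmin ⟨k', h1.1⟩).not_gt h1.2
  obtain ⟨t, ht⟩ := exists_path_inner_eq (e := e) γ
    ((hi.inner_le he (Or.inl hl)).trans hlm.le) (hmk.le.trans (hj k))
  have hp : γ t ∈ region P := h.1 ⟨t, rfl⟩
  have hpV : γ t ∈ Set.range γ \ Set.range P.vertices := by
    refine ⟨⟨t, rfl⟩, ?_⟩
    rintro ⟨k', hk'⟩
    exact hc k' (by rw [hk', ht]; exact ⟨hlm, hmk⟩)
  have hseg := hσ.openSegment_subset hP he hmono hl hc hp (ht ▸ hlm) (ht ▸ hmk)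
  refine ⟨_, ⟨_, hpV, rfl⟩, γ t, mem_connectedComponentIn hpV, ?_⟩
  rintro z ⟨hz, hzn⟩
  simp only [Set.mem_insert_iff, Set.mem_singleton_iff, not_or] at hzn
  exact hseg (mem_openSegment_of_mem_segment hz hzn.1 hzn.2)

lemma IsGeodesic.isHiddenOpenMobileGuardSet {σ : ℝ} (hσ : IsOuterSign P σ) (hP : IsSimple P)
    {e : Plane} (he : e ≠ 0) (hmono : IsMonotoneIn P e) {i j : Fin n} (hi : IsLeftmost P e i)
    (hj : IsRightmost P e j) {γ : Path (P i) (P j)} (h : IsGeodesic P γ) :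
    IsHiddenOpenMobileGuardSet P (openEdges P γ) where
  mobile := by
    rintro _ ⟨x, hx, rfl⟩
    obtain ⟨_, ⟨a, rfl⟩, _, ⟨b, rfl⟩, hab, hsub, heq⟩ :=
      (h.isLocallyLine hσ hP).connectedComponentIn_eq (isCompact_range γ.continuous) hx
    rw [heq]
    exact hσ.isOpenMobileGuard hP hab fun z hz => ⟨h.1 (hsub hz).1, (hsub hz).2⟩
  guards := fun _ hl => h.exists_sees hσ hP he hmono hi hj hl
  hidden := by
    rintro _ ⟨x, hx, rfl⟩ _ ⟨y, hy, rfl⟩ hne ⟨p, hp, q, hq, hvis⟩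
    apply hne
    obtain ⟨⟨s, rfl⟩, hs⟩ := connectedComponentIn_subset _ _ hp
    obtain ⟨⟨t, rfl⟩, ht⟩ := connectedComponentIn_subset _ _ hq
    rw [connectedComponentIn_eq hp, connectedComponentIn_eq hq]
    rcases le_total s t with hst | hst
    · exact connectedComponentIn_eq (h.mem_connectedComponentIn_of_visible hst hs ht hvis)
    · exact (connectedComponentIn_eq
        (h.mem_connectedComponentIn_of_visible hst ht hs hvis.symm)).symm

end HiddenGuards

theorem mainTheorem2 {n : ℕ} (P : Polygon HiddenGuards.Plane n)
    (hP : HiddenGuards.IsSimple P) (hmono : HiddenGuards.IsMonotone P) :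
    HiddenGuards.AdmitsHiddenOpenMobileGuardSet P ∧
    ∀ e : HiddenGuards.Plane, ‖e‖ = 1 → HiddenGuards.IsMonotoneIn P e →
      ∀ i j : Fin n, HiddenGuards.IsLeftmost P e i → HiddenGuards.IsRightmost P e j →
        (∃ γ : Path (P i) (P j), HiddenGuards.IsGeodesic P γ) ∧
        ∀ γ : Path (P i) (P j), HiddenGuards.IsGeodesic P γ →
          HiddenGuards.IsHiddenOpenMobileGuardSet P (HiddenGuards.openEdges P γ) ∧
          ∀ c : ℝ, (HiddenGuards.region P ∩ HiddenGuards.crossLine e c).Nonempty →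
            (Set.range γ ∩ HiddenGuards.crossLine e c).Nonempty := by
  have hne : ∀ e : HiddenGuards.Plane, ‖e‖ = 1 → e ≠ 0 := fun e he =>
    norm_ne_zero_iff.1 (he ▸ one_ne_zero)
  constructor
  · obtain ⟨e, he, h⟩ := hmono
    obtain ⟨σ, hσ⟩ := hP.exists_isOuterSign (hne e he) h
    obtain ⟨i, hi⟩ := hP.exists_isLeftmost e
    obtain ⟨j, hj⟩ := hP.exists_isRightmost e
    obtain ⟨γ, hγ, -⟩ := HiddenGuards.exists_isGeodesic P i j
    exact ⟨_, hγ.isHiddenOpenMobileGuardSet hσ hP (hne e he) h hi hj⟩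
  · intro e he h i j hi hj
    obtain ⟨σ, hσ⟩ := hP.exists_isOuterSign (hne e he) h
    refine ⟨(HiddenGuards.exists_isGeodesic P i j).imp fun γ hγ => hγ.1, fun γ hγ =>
      ⟨hγ.isHiddenOpenMobileGuardSet hσ hP (hne e he) h hi hj, ?_⟩⟩
    rintro c ⟨z, hz, rfl⟩
    obtain ⟨t, ht⟩ := HiddenGuards.exists_path_inner_eq γ (hi.inner_le (hne e he) hz)
      (HiddenGuards.inner_le_of_mem_region (hne e he) hj hz)
    exact ⟨γ t, ⟨t, rfl⟩, ht⟩
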